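/- Let $\Omega$ be a measurable space, $G_0$ a finite nonzero measure on $\Omega$, $c>0$, and $p_j\in(0,1)$ for $j$ in a finite set $J$ of groups. For a finite measure $H$ on $\Omega$: - $\mathrm{GaP}(c,H)$ (gamma process) is the law of an almost surely finite random measure whose masses on disjoint measurable sets are independent, the mass of $A$ having the law $\mathrm{Gamma}(H(A),1/c)$ (shape, scale; shape $0$ is the point mass at $0$); - $\mathrm{PP}(H)$ (Poisson process) is the law of an almost surely finite random measure whose masses on disjoint measurable sets are independent, the mass of $A$ having the law $\mathrm{Poisson}(H(A))$; - for $a>0$ and $H$ a probability measure, $\mathrm{DP}(a,H)$ (Dirichlet process) is the law of a random probability measure whose masses on every finite measurable partition $A_0,\dots,A_Q$ of $\Omega$ have the law $\mathrm{Dirichlet}(aH(A_0),\dots,aH(A_Q))$ (a zero parameter meaning that the corresponding mass is almost surely $0$). Consider a gamma-negative binomial (gamma-NB) process in its gamma-gamma-Poisson form, on some probability space: $$X_j\sim \mathrm{PP}(\Lambda_j),\qquad \Lambda_j\sim\mathrm{GaP}\big((1-p_j)/p_j,\,G\big),\qquad G\sim \mathrm{GaP}(c,G_0),$$ that is, given $G$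 the $\Lambda_j$ are independent with the stated conditional laws, and given $G$ and all the $\Lambda_j$ the $X_j$ are independent with the stated conditional laws. Put $\gamma_0=G_0(\Omega)$, $\widetilde G_0=G_0/\gamma_0$, $\alpha=G(\Omega)$, $\widetilde G=G/\alpha$, $T_j=\Lambda_j(\Omega)$, $\widetilde\Lambda_j=\Lambda_j/T_j$ and $N_j=X_j(\Omega)$, which is almost surely a natural number. Then the normalized model is a hierarchical Dirichlet process: 1. $\alpha\sim\mathrm{Gamma}(\gamma_0,1/c)$. 2. $\widetilde G\sim\mathrm{DP}(\gamma_0,\widetilde G_0)$, and $\widetilde G$ is independent of $(\alpha,(T_j)_j,(N_j)_j)$. 3. Given $\alpha,(T_j)_j,(N_j)_j,\widetilde G$, the $\widetilde\Lambda_j$ are independent with $\widetilde\Lambda_j\sim\mathrm{DP}(\alpha,\widetilde G)$. 4. Given $\alpha,(T_j)_j,(N_j)_j,\widetilde G,(\widetilde\Lambda_j)_j$, the $X_j$ are independent, and $X_j$ has the law of $\sum_{i=1}^{N_j}\delta_{Y_{ji}}$ with $Y_{j1},\dots,Y_{jN_j}$ independent of law $\widetilde\Lambda_j$. Moreover, if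 the points of the groups are listed as random points, $X_j=\sum_{i=1}^{N_j}\delta_{X_{ji}}$ almost surely, so that the joint law of $G$, $(\Lambda_j)_j$ and the points $(X_{ji})_{j,i}$ is invariant under all permutations of the points within the groups, then under the same conditioning all the $X_{ji}$ are independent with $X_{ji}\sim\widetilde\Lambda_j$. -/

import Mathlib

open MeasureTheory ProbabilityTheory

noncomputable section

namespace GammaNB

/-- The gamma distribution with shape `a ≥ 0` and rate `r > 0` (scale `1 / r`); shape `0` is the
point mass at `0`. -/
def gammaDist (a r : ℝ) : Measure ℝ :=
  if a = 0 then Measure.dirac 0 else gammaMeasure a r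

/-- Density of the Dirichlet distribution with parameters `a 0, …, a n > 0`, in the first `n`
coordinates. -/
def dirichletPDF {n : ℕ} (a : Fin (n + 1) → ℝ) (y : Fin n → ℝ) : ℝ :=
  open Classical in
  if (∀ i, 0 < y i) ∧ ∑ i, y i < 1 then
    Real.Gamma (∑ q, a q) / (∏ q, Real.Gamma (a q)) *
      (∏ i, y i ^ (a i.castSucc - 1)) * (1 - ∑ i, y i) ^ (a (Fin.last n) - 1)
  else 0

/-- The Dirichlet distribution with positive parameters, as a measure on `ℝ ^ (n + 1)`; the last
coordinate is one minus the sum of the others. -/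
def dirichletMeasure {n : ℕ} (a : Fin (n + 1) → ℝ) : Measure (Fin (n + 1) → ℝ) :=
  ((volume : Measure (Fin n → ℝ)).withDensity fun y => ENNReal.ofReal (dirichletPDF a y)).map
    fun y => Fin.snoc (α := fun _ => ℝ) y (1 - ∑ i, y i)

variable {Ω : Type*} [MeasurableSpace Ω]

/-- `ρ` is the law of a gamma process `GaP(c, H)`: an almost surely finite random measure whose
masses on disjoint measurable sets are independent, the mass of `A` being `Gamma(H(A), 1 / c)`. -/
structure IsGammaProcessLaw (c : ℝ) (H : Measure Ω) (ρ : Measure (Measure Ω)) : Prop where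
  prob : IsProbabilityMeasure ρ
  finite : ∀ᵐ μ ∂ρ, IsFiniteMeasure μ
  fidi : ∀ (Q : ℕ) (A : Fin Q → Set Ω), (∀ q, MeasurableSet (A q)) →
    Pairwise (fun q r => Disjoint (A q) (A r)) →
    ρ.map (fun μ q => μ.real (A q)) = Measure.pi fun q => gammaDist (H.real (A q)) c

/-- `ρ` is the law of a Poisson process `PP(H)` with finite mean measure `H`: a random measure
whose masses on disjoint measurable sets are independent, the mass of `A` being
`Poisson(H(A))`. -/
structure IsPoissonProcessLaw (H : Measure Ω) (ρ : Measure (Measure Ω)) : Prop where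
  prob : IsProbabilityMeasure ρ
  finite : ∀ᵐ μ ∂ρ, IsFiniteMeasure μ
  fidi : ∀ (Q : ℕ) (A : Fin Q → Set Ω), (∀ q, MeasurableSet (A q)) →
    Pairwise (fun q r => Disjoint (A q) (A r)) →
    ρ.map (fun μ q => μ.real (A q)) =
      Measure.pi fun q => (poissonMeasure (H.real (A q)).toNNReal).map (fun n : ℕ => (n : ℝ))

/-- `ρ` is the law of a Dirichlet process `DP(a, H)`: an almost sure random probability measure
whose masses on a finite measurable partition are `Dirichlet(a H(A_0), …, a H(A_Q))`, where a
zero parameter means that the corresponding mass vanishes almost surely. -/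
structure IsDirichletProcessLaw (a : ℝ) (H : Measure Ω) (ρ : Measure (Measure Ω)) : Prop where
  prob : IsProbabilityMeasure ρ
  prob_ae : ∀ᵐ μ ∂ρ, IsProbabilityMeasure μ
  null : ∀ A : Set Ω, MeasurableSet A → H A = 0 → ∀ᵐ μ ∂ρ, μ A = 0
  fidi : ∀ (Q : ℕ) (A : Fin (Q + 1) → Set Ω), (∀ q, MeasurableSet (A q)) →
    Pairwise (fun q r => Disjoint (A q) (A r)) → (⋃ q, A q) = Set.univ → (∀ q, 0 < H (A q)) →
    ρ.map (fun μ q => μ.real (A q)) = dirichletMeasure fun q => a * H.real (A q)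

/-- `ρ` is a product over `j` of laws of which the `j`-th one satisfies `L j`. -/
def IsProductLaw {J E : Type*} [Fintype J] [MeasurableSpace E]
    (L : J → Measure E → Prop) (ρ : Measure (J → E)) : Prop :=
  ∃ r : J → Measure E, (∀ j, L j (r j)) ∧ ρ = Measure.pi r

/-- Under `P`, the conditional law of `Y` given `Z` is, almost surely, a law that
satisfies `L Z`. -/
def HasCondLaw {S E F : Type*} [MeasurableSpace S] [MeasurableSpace E] [MeasurableSpace F]
    (P : Measure S) (Y : S → F) (Z : S → E) (L : E → Measure F → Prop) : Prop :=
  ∃ κ : Kernel E F, IsMarkovKernel κ ∧ HasCondDistrib Y Z κ P ∧ ∀ᵐ z ∂(P.map Z), L z (κ z)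

/-- The hierarchy `X_j ~ PP(Λ_j)`, `Λ_j ~ GaP((1 - p_j) / p_j, G)`, `G ~ GaP(c, G₀)`: given `G`
the `Λ_j` are independent, and given `G` and all `Λ_j` the `X_j` are independent. -/
structure IsGammaNBProcess {S J : Type*} [MeasurableSpace S] [Fintype J] (P : Measure S)
    (c : ℝ) (G₀ : Measure Ω) (p : J → ℝ)
    (G : S → Measure Ω) (Λ X : J → S → Measure Ω) : Prop where
  measurable_G : Measurable G
  measurable_Λ : ∀ j, Measurable (Λ j)
  measurable_X : ∀ j, Measurable (X j)
  law_G : IsGammaProcessLaw c G₀ (P.map G)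
  law_Λ : HasCondLaw P (fun s j => Λ j s) G
    fun g => IsProductLaw fun j => IsGammaProcessLaw ((1 - p j) / p j) g
  law_X : HasCondLaw P (fun s j => X j s) (fun s => (G s, fun j => Λ j s))
    fun z => IsProductLaw fun j => IsPoissonProcessLaw (z.2 j)

/-- The normalization `μ / μ(Ω)`. -/
def normalize (μ : Measure Ω) : Measure Ω := (μ Set.univ)⁻¹ • μ

/-- A finite ordered list of points of `Ω`, of variable length. -/
abbrev Points (Ω : Type*) : Type _ := Σ n : ℕ, (Fin n → Ω)

/-- The counting measure `∑ i, δ_{x i}` of a list of points. -/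
def counting (x : Points Ω) : Measure Ω := ∑ i, Measure.dirac (x.2 i)

/-- Reordering a list of points by a permutation chosen according to its length. -/
def reorder {Ω : Type*} (τ : ∀ n : ℕ, Equiv.Perm (Fin n)) (x : Points Ω) : Points Ω :=
  ⟨x.1, fun i => x.2 (τ x.1 i)⟩

/-- The law of a list of `n` independent points with common law `ν`. -/
def iidPoints (n : ℕ) (ν : Measure Ω) : Measure (Points Ω) :=
  (Measure.pi fun _ : Fin n => ν).map (fun y => (⟨n, y⟩ : Points Ω))

/-- `x_j` lists the points `X_{j1}, …, X_{jN_j}` of `X_j`, in an order that carries no information: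
jointly with `G` and all `Λ_j`, the points are exchangeable within each group. -/
structure IsExchangeableListing {S J : Type*} [MeasurableSpace S] (P : Measure S)
    (G : S → Measure Ω) (Λ X : J → S → Measure Ω) (x : J → S → Points Ω) : Prop where
  measurable : ∀ j, Measurable (x j)
  counting_eq : ∀ j, ∀ᵐ s ∂P, X j s = counting (x j s)
  exchangeable : ∀ τ : J → ∀ n : ℕ, Equiv.Perm (Fin n),
    P.map (fun s => ((G s, fun j => Λ j s), fun j => reorder (τ j) (x j s))) =
      P.map (fun s => ((G s, fun j => Λ j s), fun j => x j s))

end GammaNB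

end

/-! Everything rests on the gamma–Dirichlet algebra: for independent gamma variables of a common
rate, the sum is independent of the proportions, because in the coordinates (total, proportions) the
product density splits into a gamma density times a Dirichlet density
(`pi_gammaMeasure_map_total_proportions`). Read on all finite partitions, this says that the total
mass of a gamma process is independent of its normalization, which is a Dirichlet process
(`IsGammaProcessLaw.map_total_normalize`, `IsGammaProcessLaw.isDirichletProcessLaw_normalize`). The
Poisson counterpart is that a Poisson process is a Poisson number of independent draws from its
normalized mean measure (`IsPoissonProcessLaw.eq_map_counting`).

The hierarchy then separates. The totals form a chain of their own: given `G`, the `T_j` are gamma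
with shape `α`, and given the `Λ_j`, the `N_j` are Poisson with means `T_j`. This chain sees `G`
only through `α`, so it inherits the independence of `α` from `G̃` (`indepFun_normalize_totals`).
Given `G`, the `Λ̃_j` are independent of the `T_j`, hence of the `N_j` drawn from them, so
conditioning on the totals does not alter their Dirichlet process laws (`hasCondLaw_normalizeAll`).
Given the numbers `N_j`, only independent draws from the `Λ̃_j` remain (`hasCondLaw_iidPoints`).

For listed points, a law of lists that is invariant under reordering is determined by the law of the
counting measures (`ext_of_map_counting`), so an exchangeable listing must have the law of
independent draws.

`Ω` is an arbitrary measurable space, so conditional laws are not taken from a disintegration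
theorem: they are explicit kernels, pulled back along `(α, G̃) ↦ α G̃`, which recovers `G`. -/

noncomputable section

namespace GammaNB

/-! ### Finite products of measures, densities and Markov kernels. -/

section ProductKernels

variable {ι : Type*} [Fintype ι] {E : ι → Type*} [∀ i, MeasurableSpace (E i)]

theorem lintegral_fin_prod {n : ℕ} {E : Fin n → Type*} [∀ i, MeasurableSpace (E i)]
    (μ : ∀ i, Measure (E i)) [∀ i, SigmaFinite (μ i)] {f : ∀ i, E i → ENNReal}
    (hf : ∀ i, Measurable (f i)) :
    ∫⁻ x, ∏ i, f i (x i) ∂Measure.pi μ = ∏ i, ∫⁻ y, f i y ∂μ i := by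
  induction n with
  | zero => simp
  | succ n ih =>
    rw [← (measurePreserving_piFinSuccAbove μ 0).symm.lintegral_comp_emb
      (MeasurableEquiv.measurableEmbedding _)]
    simp only [MeasurableEquiv.piFinSuccAbove_symm_apply, Fin.prod_univ_succAbove _ (0 : Fin (n + 1)),
      Fin.insertNthEquiv_apply, Fin.insertNth_apply_same, Fin.insertNth_apply_succAbove]
    rw [lintegral_prod_mul (f := f 0)
      (g := fun y : ∀ j, E (Fin.succAbove 0 j) => ∏ i : Fin n, f (Fin.succAbove 0 i) (y i))
      (hf 0).aemeasurable, ih _ fun i => hf _]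
    exact (Finset.measurable_prod _ fun i _ =>
        (hf _).comp (measurable_pi_apply i)).aemeasurable

/-- Tonelli's theorem for products of functions of single coordinates. -/
theorem lintegral_pi_prod (μ : ∀ i, Measure (E i)) [∀ i, SigmaFinite (μ i)]
    {f : ∀ i, E i → ENNReal} (hf : ∀ i, Measurable (f i)) :
    ∫⁻ x, ∏ i, f i (x i) ∂Measure.pi μ = ∏ i, ∫⁻ y, f i y ∂μ i := by
  let e := (Fintype.equivFin ι).symm
  rw [← (measurePreserving_piCongrLeft μ e).lintegral_comp_emb
    (MeasurableEquiv.measurableEmbedding _)]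
  simp_rw [← e.prod_comp, MeasurableEquiv.coe_piCongrLeft, Equiv.piCongrLeft_apply_apply]
  exact lintegral_fin_prod _ fun i => hf _

theorem pi_withDensity (μ : ∀ i, Measure (E i)) [∀ i, SigmaFinite (μ i)]
    {f : ∀ i, E i → ENNReal} (hf : ∀ i, Measurable (f i))
    [∀ i, SigmaFinite ((μ i).withDensity (f i))] :
    Measure.pi (fun i => (μ i).withDensity (f i)) =
      (Measure.pi μ).withDensity fun x => ∏ i, f i (x i) := by
  refine Measure.pi_eq fun s hs => ?_
  rw [withDensity_apply _ (MeasurableSet.univ_pi hs), Measure.restrict_pi_pi,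
    lintegral_pi_prod _ hf]
  exact Finset.prod_congr rfl fun i _ => (withDensity_apply _ (hs i)).symm

/-- The product of a finite family of Markov kernels with the same source. -/
def piKernel {A : Type*} [MeasurableSpace A] (κ : ∀ i, Kernel A (E i))
    [∀ i, IsMarkovKernel (κ i)] : Kernel A (∀ i, E i) where
  toFun a := Measure.pi fun i => κ i a
  measurable' := by
    refine Measurable.measure_of_isPiSystem_of_isProbabilityMeasure generateFrom_pi.symm
      isPiSystem_pi ?_
    rintro _ ⟨s, hs, rfl⟩
    simp_rw [Measure.pi_pi]
    exact Finset.measurable_prod _ fun i _ => (κ i).measurable_coe (hs i (Set.mem_univ i))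

theorem piKernel_apply {A : Type*} [MeasurableSpace A] (κ : ∀ i, Kernel A (E i))
    [∀ i, IsMarkovKernel (κ i)] (a : A) : piKernel κ a = Measure.pi fun i => κ i a := rfl

instance {A : Type*} [MeasurableSpace A] (κ : ∀ i, Kernel A (E i))
    [∀ i, IsMarkovKernel (κ i)] : IsMarkovKernel (piKernel κ) :=
  ⟨fun a => by rw [piKernel_apply]; infer_instance⟩

/-- A product of semidirect products is the semidirect product of the products. -/
theorem pi_compProd {A B : ι → Type*} [∀ i, MeasurableSpace (A i)] [∀ i, MeasurableSpace (B i)]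
    (β : ∀ i, Measure (A i)) [∀ i, IsProbabilityMeasure (β i)]
    (Q : ∀ i, Kernel (A i) (B i)) [∀ i, IsMarkovKernel (Q i)] :
    (Measure.pi fun i => β i ⊗ₘ Q i).map (fun y => (fun i => (y i).1, fun i => (y i).2)) =
      Measure.pi β ⊗ₘ piKernel fun i => (Q i).comap (fun a => a i) (measurable_pi_apply i) := by
  have hzip : Measurable fun (z : (∀ i, A i) × (∀ i, B i)) i => (z.1 i, z.2 i) := by fun_prop
  -- A measurable set of pairs need not be a rectangle, so the identity is tested on products of
  -- arbitrary sets `s i` of pairs, in zipped form; unzipping comes last.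
  have h : Measure.pi (fun i => β i ⊗ₘ Q i) =
      (Measure.pi β ⊗ₘ piKernel fun i => (Q i).comap (fun a => a i) (measurable_pi_apply i)).map
        (fun z i => (z.1 i, z.2 i)) := by
    refine Measure.pi_eq fun s hs => ?_
    rw [Measure.map_apply hzip (MeasurableSet.univ_pi hs),
      Measure.compProd_apply (hzip (MeasurableSet.univ_pi hs))]
    have (a : ∀ i, A i) : (piKernel fun i => (Q i).comap (fun a : ∀ i, A i => a i)
        (measurable_pi_apply i)) a
          (Prod.mk a ⁻¹' ((fun z i => (z.1 i, z.2 i)) ⁻¹' Set.univ.pi s)) =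
        ∏ i, Q i (a i) (Prod.mk (a i) ⁻¹' s i) := by
      rw [piKernel_apply]
      simp only [Kernel.comap_apply]
      rw [← Measure.pi_pi]
      rfl
    simp_rw [this]
    rw [lintegral_pi_prod β fun i => Kernel.measurable_kernel_prodMk_left (hs i)]
    exact Finset.prod_congr rfl fun i _ => (Measure.compProd_apply (hs i)).symm
  rw [h, Measure.map_map (by fun_prop) hzip]
  exact Measure.map_id

end ProductKernels

/-! ### The gamma–Dirichlet factorization in finite dimension. -/

section GammaDirichlet

/-- The density of the gamma distribution, with the value `0` at the origin. -/
def gammaDensity (a r x : ℝ) : ℝ :=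
  if 0 < x then r ^ a / Real.Gamma a * x ^ (a - 1) * Real.exp (-(r * x)) else 0

theorem measurable_gammaDensity (a r : ℝ) : Measurable (gammaDensity a r) :=
  Measurable.ite measurableSet_Ioi (by fun_prop) measurable_const

/-- Changing the density at the single point `0` is harmless, and it makes the factorization below
hold pointwise, also on the boundary of the simplex, where `dirichletPDF` vanishes. -/
theorem gammaMeasure_eq_withDensity (a r : ℝ) :
    gammaMeasure a r = volume.withDensity fun x => ENNReal.ofReal (gammaDensity a r x) := by
  refine withDensity_congr_ae ?_
  filter_upwards [Measure.ae_ne volume (0 : ℝ)] with x hx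
  rw [gammaPDF_eq, gammaDensity]
  rcases lt_or_gt_of_ne hx with h | h
  · rw [if_neg (not_le.2 h), if_neg (not_lt.2 h.le)]
  · rw [if_pos h.le, if_pos h]

theorem measurable_dirichletPDF {n : ℕ} (a : Fin (n + 1) → ℝ) : Measurable (dirichletPDF a) := by
  unfold dirichletPDF
  refine Measurable.ite ?_ (by fun_prop) measurable_const
  have h : {y : Fin n → ℝ | (∀ i, 0 < y i) ∧ ∑ i, y i < 1} =
      (⋂ i, {y | 0 < y i}) ∩ {y | ∑ i, y i < 1} := by ext; simp
  rw [h]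
  exact (MeasurableSet.iInter fun i => measurableSet_lt measurable_const
    (measurable_pi_apply i)).inter (measurableSet_lt (by fun_prop) measurable_const)

theorem measurable_snoc_one_sub_sum {n : ℕ} :
    Measurable fun y : Fin n → ℝ => Fin.snoc (α := fun _ => ℝ) y (1 - ∑ i, y i) := by
  refine measurable_pi_iff.2 fun q => ?_
  refine Fin.lastCases ?_ (fun i => ?_) q
  · simp only [Fin.snoc_last]; fun_prop
  · simp only [Fin.snoc_castSucc]; fun_prop

/-- In the coordinates `(total, proportions)`, the product of gamma densities factorizes. -/
theorem prod_gammaDensity_smul {n : ℕ} {a : Fin (n + 1) → ℝ} (ha : ∀ q, 0 < a q) {c : ℝ}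
    (hc : 0 < c) {s : ℝ} (hs : 0 < s) (y : Fin n → ℝ) :
    s ^ n * ((∏ i : Fin n, gammaDensity (a i.castSucc) c (s * y i)) *
        gammaDensity (a (Fin.last n)) c (s * (1 - ∑ i, y i))) =
      gammaDensity (∑ q, a q) c s * dirichletPDF a y := by
  unfold dirichletPDF
  split_ifs with h
  · obtain ⟨h1, h2⟩ := h
    have h3 : 0 < 1 - ∑ i, y i := by linarith
    have hΓ : ∀ q, Real.Gamma (a q) ≠ 0 := fun q => (Real.Gamma_pos_of_pos (ha q)).ne'
    have hA : Real.Gamma (∑ q, a q) ≠ 0 :=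
      (Real.Gamma_pos_of_pos (Finset.sum_pos (fun q _ => ha q) Finset.univ_nonempty)).ne'
    simp only [gammaDensity, hs, mul_pos hs (h1 _), mul_pos hs h3, if_true]
    rw [Real.mul_rpow hs.le h3.le]
    simp_rw [fun i => Real.mul_rpow hs.le (h1 i).le (z := a (Fin.castSucc i) - 1)]
    simp only [Finset.prod_mul_distrib, Finset.prod_div_distrib]
    rw [← Real.exp_sum, ← Real.rpow_sum_of_pos hc, ← Real.rpow_sum_of_pos hs,
      Fin.sum_univ_castSucc a, Fin.prod_univ_castSucc (fun q => Real.Gamma (a q))]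
    have e1 : Real.exp (-(c * s)) =
        Real.exp (∑ i : Fin n, -(c * (s * y i))) * Real.exp (-(c * (s * (1 - ∑ i, y i)))) := by
      rw [← Real.exp_add]
      congr 1
      rw [Finset.sum_neg_distrib, ← Finset.mul_sum, ← Finset.mul_sum]
      ring
    -- The Jacobian `s ^ n` absorbs the `-1` in the exponents of the first `n` coordinates; the `-1`
    -- of the last one is that of the gamma density of the total.
    have e2 : s ^ (∑ i : Fin n, a i.castSucc + a (Fin.last n) - 1) =
        s ^ n * (s ^ (∑ i : Fin n, (a i.castSucc - 1)) * s ^ (a (Fin.last n) - 1)) := by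
      rw [← Real.rpow_natCast s n, ← Real.rpow_add hs, ← Real.rpow_add hs]
      congr 1
      rw [Finset.sum_sub_distrib, Finset.sum_const, Finset.card_univ, Fintype.card_fin,
        nsmul_eq_mul]
      ring
    rw [e1, e2, Real.rpow_add hc]
    rw [Fin.sum_univ_castSucc a] at hA
    have hP : (∏ i : Fin n, Real.Gamma (a i.castSucc)) ≠ 0 :=
      Finset.prod_ne_zero_iff.2 fun i _ => hΓ _
    have hL := hΓ (Fin.last n)
    field_simp
  · rw [mul_zero]
    -- Off the open simplex some coordinate of the scaled point is nonpositive, so a gamma factor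
    -- vanishes as well.
    have h' : (∃ i, y i ≤ 0) ∨ 1 - ∑ i, y i ≤ 0 := by
      by_contra hcon
      push Not at hcon
      exact h ⟨hcon.1, by linarith [hcon.2]⟩
    rcases h' with ⟨i, hi⟩ | hi
    · rw [Finset.prod_eq_zero (Finset.mem_univ i), zero_mul, mul_zero]
      rw [gammaDensity, if_neg (not_lt.2 (mul_nonpos_of_nonneg_of_nonpos hs.le hi))]
    · have h0 : gammaDensity (a (Fin.last n)) c (s * (1 - ∑ i, y i)) = 0 :=
        if_neg (not_lt.2 (mul_nonpos_of_nonneg_of_nonpos hs.le hi))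
      rw [h0, mul_zero, mul_zero]

theorem gammaDensity_nonneg {a r : ℝ} (ha : 0 < a) (hr : 0 < r) (x : ℝ) :
    0 ≤ gammaDensity a r x := by
  unfold gammaDensity
  split_ifs
  · have := Real.Gamma_pos_of_pos ha
    positivity
  · exact le_rfl

/-- Integration over `ℝ ^ (n + 1)` in the coordinates `(total, proportions)`. -/
theorem lintegral_total_proportions {n : ℕ} {H : (Fin (n + 1) → ℝ) → ENNReal} (hH : Measurable H)
    (hneg : ∀ v, ∑ q, v q ≤ 0 → H v = 0) :
    ∫⁻ v, H v = ∫⁻ s in Set.Ioi (0 : ℝ), ENNReal.ofReal (s ^ n) *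
      ∫⁻ y : Fin n → ℝ, H (s • Fin.snoc (α := fun _ => ℝ) y (1 - ∑ i, y i)) := by
  have hsnoc : Measurable fun z : ℝ × (Fin n → ℝ) =>
      Fin.snoc (α := fun _ => ℝ) z.2 z.1 := by
    refine measurable_pi_iff.2 fun q => ?_
    refine Fin.lastCases ?_ (fun i => ?_) q
    · simp only [Fin.snoc_last]; fun_prop
    · simp only [Fin.snoc_castSucc]; fun_prop
  have hsub : Measurable fun z : ℝ × (Fin n → ℝ) => (z.1 - ∑ i, z.2 i, z.2) := by fun_prop
  calc ∫⁻ v, H v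
      = ∫⁻ z : ℝ × (Fin n → ℝ), H (Fin.snoc (α := fun _ => ℝ) z.2 z.1) := by
        rw [← (volume_preserving_piFinSuccAbove (fun _ : Fin (n + 1) => ℝ)
          (Fin.last n)).symm.lintegral_comp_emb (MeasurableEquiv.measurableEmbedding _)]
        refine lintegral_congr fun z => ?_
        rw [MeasurableEquiv.piFinSuccAbove_symm_apply]
        exact congrArg H (Fin.insertNth_last' _ _)
    _ = ∫⁻ y : Fin n → ℝ, ∫⁻ t : ℝ, H (Fin.snoc (α := fun _ => ℝ) y t) :=
        lintegral_prod_symm _ (hH.comp hsnoc).aemeasurable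
    -- Translation turns the last coordinate into the total, for fixed other coordinates; rescaling
    -- these by `s` afterwards produces the factor `s ^ n`.
    _ = ∫⁻ y : Fin n → ℝ, ∫⁻ s : ℝ, H (Fin.snoc (α := fun _ => ℝ) y (s - ∑ i, y i)) := by
        refine lintegral_congr fun y => ?_
        exact (lintegral_sub_right_eq_self
          (fun t => H (Fin.snoc (α := fun _ => ℝ) y t)) (∑ i, y i)).symm
    _ = ∫⁻ s : ℝ, ∫⁻ y : Fin n → ℝ, H (Fin.snoc (α := fun _ => ℝ) y (s - ∑ i, y i)) :=
        (lintegral_lintegral_swap (μ := (volume : Measure ℝ)) (ν := (volume : Measure (Fin n → ℝ)))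
          (f := fun s y => H (Fin.snoc (α := fun _ => ℝ) y (s - ∑ i, y i)))
          (hH.comp (hsnoc.comp hsub)).aemeasurable).symm
    _ = ∫⁻ s in Set.Ioi (0 : ℝ),
          ∫⁻ y : Fin n → ℝ, H (Fin.snoc (α := fun _ => ℝ) y (s - ∑ i, y i)) := by
        refine (setLIntegral_eq_of_support_subset ?_).symm
        intro s hs
        by_contra hcon
        refine hs ?_
        simp only [Set.mem_Ioi, not_lt] at hcon
        rw [lintegral_eq_zero_iff' (by
          exact (hH.comp (hsnoc.comp (hsub.comp measurable_prodMk_left))).aemeasurable)]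
        refine Filter.Eventually.of_forall fun y => hneg _ ?_
        simpa [Fin.sum_univ_castSucc] using hcon
    _ = _ := by
        refine setLIntegral_congr_fun measurableSet_Ioi fun s hs => ?_
        have hs : 0 < s := hs
        have hm : Measurable fun y : Fin n → ℝ =>
            H (Fin.snoc (α := fun _ => ℝ) y (s - ∑ i, y i)) :=
          hH.comp (hsnoc.comp (hsub.comp measurable_prodMk_left))
        have key := Measure.map_addHaar_smul (volume : Measure (Fin n → ℝ)) hs.ne'
        have key2 : (volume : Measure (Fin n → ℝ)) =
            ENNReal.ofReal (s ^ n) • Measure.map (fun y => s • y) volume := by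
          have hpos : 0 < s ^ n := by positivity
          rw [key, smul_smul, ← ENNReal.ofReal_mul hpos.le]
          simp [abs_of_pos hpos, hpos.ne']
        conv_lhs => rw [key2]
        rw [lintegral_smul_measure, lintegral_map hm (measurable_const_smul s), smul_eq_mul]
        congr 1
        refine lintegral_congr fun y => congrArg H ?_
        ext q
        refine Fin.lastCases ?_ (fun i => ?_) q
        · simp [Finset.mul_sum, mul_sub]
        · simp

instance {n : ℕ} (a : Fin (n + 1) → ℝ) : SFinite (dirichletMeasure a) := by
  unfold dirichletMeasure
  infer_instance

/-- For independent gamma variables of the same scale, the total is gamma distributed and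
independent of the proportions, which have a Dirichlet distribution. -/
theorem pi_gammaMeasure_map_total_proportions {n : ℕ} {a : Fin (n + 1) → ℝ} (ha : ∀ q, 0 < a q)
    {c : ℝ} (hc : 0 < c) :
    (Measure.pi fun q => gammaMeasure (a q) c).map
        (fun v => (∑ q, v q, fun q => v q / ∑ r, v r)) =
      (gammaMeasure (∑ q, a q) c).prod (dirichletMeasure a) := by
  have hA : 0 < ∑ q, a q := Finset.sum_pos (fun q _ => ha q) Finset.univ_nonempty
  have hm : Measurable fun v : Fin (n + 1) → ℝ => (∑ q, v q, fun q => v q / ∑ r, v r) := by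
    fun_prop
  have hd (a : ℝ) : Measurable fun x => ENNReal.ofReal (gammaDensity a c x) :=
    (measurable_gammaDensity a c).ennreal_ofReal
  have hdir : Measurable fun y => ENNReal.ofReal (dirichletPDF a y) :=
    (measurable_dirichletPDF a).ennreal_ofReal
  have : ∀ q, SigmaFinite ((volume : Measure ℝ).withDensity
      fun x => ENNReal.ofReal (gammaDensity (a q) c x)) := fun q =>
    SigmaFinite.withDensity_of_ne_top (by simp)
  refine Measure.ext_of_lintegral _ fun F hF => ?_
  have hprod : Measurable fun v : Fin (n + 1) → ℝ =>
      ∏ q, ENNReal.ofReal (gammaDensity (a q) c (v q)) :=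
    Finset.measurable_prod _ fun q _ => (hd _).comp (measurable_pi_apply q)
  simp_rw [gammaMeasure_eq_withDensity]
  rw [lintegral_map hF hm, pi_withDensity _ fun q => hd _, ← volume_pi,
    lintegral_withDensity_eq_lintegral_mul _ hprod (by exact hF.comp hm),
    lintegral_total_proportions (by exact hprod.mul (hF.comp hm)),
    lintegral_prod _ hF.aemeasurable,
    lintegral_withDensity_eq_lintegral_mul _ (hd _) (by exact hF.lintegral_prod_right')]
  -- Both sides become integrals over positive totals, where the pointwise identity
  -- `prod_gammaDensity_smul` applies; the gamma density of the total vanishes elsewhere.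
  · refine Eq.trans ?_ (setLIntegral_eq_of_support_subset (s := Set.Ioi (0 : ℝ)) ?_)
    · refine setLIntegral_congr_fun measurableSet_Ioi fun s hs => ?_
      have hs : 0 < s := hs
      simp only [Pi.mul_apply]
      have hFs : Measurable fun d => F (s, d) := hF.comp measurable_prodMk_left
      rw [dirichletMeasure, lintegral_map hFs measurable_snoc_one_sub_sum,
        lintegral_withDensity_eq_lintegral_mul _ hdir
          (by exact hFs.comp measurable_snoc_one_sub_sum)]
      have hsn : Measurable fun y : Fin n → ℝ => s • Fin.snoc (α := fun _ => ℝ) y (1 - ∑ i, y i) :=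
        measurable_snoc_one_sub_sum.const_smul s
      refine (lintegral_const_mul _ ((hprod.mul (hF.comp hm)).comp hsn)).symm.trans
        (Eq.trans (lintegral_congr fun y => ?_)
          (lintegral_const_mul _ (hdir.mul (hFs.comp measurable_snoc_one_sub_sum))))
      have hsum : ∑ q, (s • Fin.snoc (α := fun _ => ℝ) y (1 - ∑ i, y i)) q = s := by
        simp [Fin.sum_univ_castSucc, ← Finset.mul_sum]
      have hpt : (fun q => (s • Fin.snoc (α := fun _ => ℝ) y (1 - ∑ i, y i)) q / s) =
          Fin.snoc (α := fun _ => ℝ) y (1 - ∑ i, y i) := by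
        ext q
        simp [hs.ne']
      simp only [Pi.mul_apply, Function.comp_apply]
      rw [hsum, hpt, ← mul_assoc, ← mul_assoc, ← ENNReal.ofReal_prod_of_nonneg
        (fun q _ => gammaDensity_nonneg (ha q) hc _), ← ENNReal.ofReal_mul (by positivity),
        ← ENNReal.ofReal_mul (gammaDensity_nonneg hA hc _), ← prod_gammaDensity_smul ha hc hs y]
      simp [Fin.prod_univ_castSucc]
    · intro s hs
      by_contra hcon
      refine hs ?_
      simp only [Pi.mul_apply]
      rw [gammaDensity, if_neg (by simpa using hcon), ENNReal.ofReal_zero, zero_mul]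
  · intro v hv
    obtain ⟨q, hq⟩ : ∃ q, v q ≤ 0 := by
      by_contra hcon
      push Not at hcon
      exact absurd hv (not_le.2 (Finset.sum_pos (fun q _ => hcon q) Finset.univ_nonempty))
    simp only [Pi.mul_apply]
    rw [Finset.prod_eq_zero (Finset.mem_univ q), zero_mul]
    rw [gammaDensity, if_neg (not_lt.2 hq), ENNReal.ofReal_zero]

end GammaDirichlet

/-! ### Laws of random measures are determined by finite positive partitions. -/

section RandomMeasures

variable {Ω : Type*} [MeasurableSpace Ω]

/-- Finitely many measurable sets are, up to a null set, unions of cells of a finite measurable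
partition with cells of positive measure. -/
theorem exists_positive_partition {H : Measure Ω} (hH : H ≠ 0)
    (I : Finset {s : Set Ω // MeasurableSet s}) :
    ∃ (n : ℕ) (q : Ω → Fin (n + 1)) (N : Set Ω) (D : I → Set (Fin (n + 1))),
      Measurable q ∧ (∀ k, 0 < H (q ⁻¹' {k})) ∧ MeasurableSet N ∧ H N = 0 ∧
      ∀ i ω, ω ∉ N → (ω ∈ i.1.1 ↔ q ω ∈ D i) := by
  classical
  -- Points are classified by which sets of `I` contain them; the patterns in `B` occur on a null
  -- set.
  let q₀ : Ω → (I → Prop) := fun ω i => ω ∈ i.1.1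
  have hq₀ : Measurable q₀ := measurable_pi_iff.2 fun i => i.1.2.mem
  let B : Set (I → Prop) := {b | H (q₀ ⁻¹' {b}) = 0}
  have hNull : H (q₀ ⁻¹' B) = 0 := by
    rw [← Set.biUnion_preimage_singleton]
    exact (measure_biUnion_null_iff B.to_countable).2 fun b hb => hb
  have hne : Nonempty {b : I → Prop // 0 < H (q₀ ⁻¹' {b})} := by
    by_contra hcon
    rw [not_nonempty_iff, isEmpty_subtype] at hcon
    refine hH (Measure.measure_univ_eq_zero.1 ?_)
    have : B = Set.univ := Set.eq_univ_of_forall fun b =>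
      show H (q₀ ⁻¹' {b}) = 0 by simpa using hcon b
    rwa [this, Set.preimage_univ] at hNull
  obtain ⟨b₀⟩ := hne
  have : Fintype {b : I → Prop // 0 < H (q₀ ⁻¹' {b})} := Fintype.ofFinite _
  obtain ⟨n, hn⟩ : ∃ n, Fintype.card {b : I → Prop // 0 < H (q₀ ⁻¹' {b})} = n + 1 :=
    have := Nonempty.intro b₀
    Nat.exists_eq_succ_of_ne_zero Fintype.card_ne_zero
  let e := Fintype.equivFinOfCardEq hn
  -- Null patterns are merged into the cell of `b₀`, so that every cell is positive; membership in
  -- the sets of `I` can then be misread only on the null set `N`.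
  let g : (I → Prop) → Fin (n + 1) := fun b =>
    if h : 0 < H (q₀ ⁻¹' {b}) then e ⟨b, h⟩ else e b₀
  refine ⟨n, g ∘ q₀, q₀ ⁻¹' B, fun i => {k | (e.symm k).1 i}, ?_, fun k => ?_, ?_, hNull,
    fun i ω hω => ?_⟩
  · exact (measurable_of_countable g).comp hq₀
  · refine (e.symm k).2.trans_le (measure_mono fun ω hω => ?_)
    have h1 : q₀ ω = (e.symm k).1 := hω
    have h2 : 0 < H (q₀ ⁻¹' {q₀ ω}) := by rw [h1]; exact (e.symm k).2
    simp only [Set.mem_preimage, Function.comp_apply, Set.mem_singleton_iff, g, dif_pos h2]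
    rw [← e.eq_symm_apply]
    exact Subtype.ext h1
  · exact hq₀ (Set.to_countable B).measurableSet
  · have h2 : 0 < H (q₀ ⁻¹' {q₀ ω}) := pos_iff_ne_zero.2 hω
    have h3 : (g ∘ q₀) ω = e ⟨q₀ ω, h2⟩ := dif_pos h2
    rw [h3, Set.mem_ofPred_eq, e.symm_apply_apply]

/-- The evaluations of a measure on all measurable sets. -/
def evaluations (μ : Measure Ω) (s : {s : Set Ω // MeasurableSet s}) : ENNReal := μ s.1

theorem measurable_evaluations : Measurable (evaluations : Measure Ω → _) :=
  measurable_pi_iff.2 fun s => Measure.measurable_coe s.2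

/-- Laws of random measures can thus be compared as laws on a product indexed by all measurable
sets, with no countability assumption on `Ω`. -/
theorem measurableSpace_measure_le_comap_evaluations :
    (inferInstance : MeasurableSpace (Measure Ω)) ≤
      MeasurableSpace.comap evaluations MeasurableSpace.pi := by
  refine iSup₂_le fun s hs => ?_
  rw [← measurable_iff_comap_le]
  have h : Measurable[MeasurableSpace.comap evaluations MeasurableSpace.pi]
      (evaluations : Measure Ω → _) := comap_measurable _
  exact (measurable_pi_apply (⟨s, hs⟩ : {s : Set Ω // MeasurableSet s})).comp h

theorem measurable_real_apply {s : Set Ω} (hs : MeasurableSet s) :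
    Measurable fun μ : Measure Ω => μ.real s :=
  (Measure.measurable_coe hs).ennreal_toReal

theorem measurable_real_partition {n : ℕ} {q : Ω → Fin n} (hq : Measurable q) :
    Measurable fun (μ : Measure Ω) k => μ.real (q ⁻¹' {k}) :=
  measurable_pi_iff.2 fun k => measurable_real_apply (hq (measurableSet_singleton k))

theorem measurableSet_isFiniteMeasure : MeasurableSet {μ : Measure Ω | IsFiniteMeasure μ} := by
  simp_rw [isFiniteMeasure_iff]
  exact measurableSet_lt (Measure.measurable_coe MeasurableSet.univ) measurable_const

/-- Two laws of finite random measures that charge no `H`-null set agree if the masses of the cells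
of every finite partition into `H`-positive sets have the same law. -/
theorem ext_of_map_partition {H : Measure Ω} (hH : H ≠ 0) {ρ₁ ρ₂ : Measure (Measure Ω)}
    [IsFiniteMeasure ρ₁]
    (hfin₁ : ∀ᵐ μ ∂ρ₁, IsFiniteMeasure μ) (hfin₂ : ∀ᵐ μ ∂ρ₂, IsFiniteMeasure μ)
    (hnull₁ : ∀ A, MeasurableSet A → H A = 0 → ∀ᵐ μ ∂ρ₁, μ A = 0)
    (hnull₂ : ∀ A, MeasurableSet A → H A = 0 → ∀ᵐ μ ∂ρ₂, μ A = 0)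
    (h : ∀ (n : ℕ) (q : Ω → Fin (n + 1)), Measurable q → (∀ k, 0 < H (q ⁻¹' {k})) →
      ρ₁.map (fun μ k => μ.real (q ⁻¹' {k})) = ρ₂.map (fun μ k => μ.real (q ⁻¹' {k}))) :
    ρ₁ = ρ₂ := by
  classical
  have key : ρ₁.map evaluations = ρ₂.map evaluations := by
    have : IsFiniteMeasure (ρ₁.map evaluations) := inferInstance
    refine IsProjectiveLimit.unique (P := fun I => (ρ₁.map evaluations).map I.restrict)
      (fun I => rfl) fun I => ?_
    have hr : Measurable (I.restrict : (({s : Set Ω // MeasurableSet s}) → ENNReal) → _) :=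
      Finset.measurable_restrict I
    beta_reduce
    rw [Measure.map_map hr measurable_evaluations, Measure.map_map hr measurable_evaluations]
    obtain ⟨n, q, N, D, hq, hpos, hN, hN0, hD⟩ := exists_positive_partition hH I
    -- For finite measures that do not charge `N`, the masses of the sets of `I` are sums of cell
    -- masses.
    let Φ : (Fin (n + 1) → ℝ) → (I → ENNReal) := fun v i =>
      ∑ k, if k ∈ D i then ENNReal.ofReal (v k) else 0
    have hΦ : Measurable Φ := by
      refine measurable_pi_iff.2 fun i => Finset.measurable_sum _ fun k _ => ?_
      split_ifs
      · fun_prop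
      · exact measurable_const
    have hmap (ρ : Measure (Measure Ω)) (hfin : ∀ᵐ μ ∂ρ, IsFiniteMeasure μ)
        (hnull : ∀ᵐ μ ∂ρ, μ N = 0) : ρ.map (I.restrict ∘ evaluations) =
          (ρ.map (fun μ k => μ.real (q ⁻¹' {k}))).map Φ := by
      rw [Measure.map_map hΦ (measurable_real_partition hq)]
      refine Measure.map_congr ?_
      filter_upwards [hfin, hnull] with μ hμ hμN
      ext i
      have h1 : μ i.1.1 = μ (q ⁻¹' D i) := by
        refine measure_congr ?_
        filter_upwards [measure_eq_zero_iff_ae_notMem.1 hμN] with ω hω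
        exact propext (hD i ω hω)
      have h2 : q ⁻¹' D i = ⋃ k ∈ Finset.univ.filter (· ∈ D i), q ⁻¹' {k} := by
        ext ω; simp
      have h3 : μ (q ⁻¹' D i) = ∑ k ∈ Finset.univ.filter (· ∈ D i), μ (q ⁻¹' {k}) := by
        rw [h2]
        refine measure_biUnion_finset (fun k _ l _ hkl => ?_)
          fun k _ => hq (measurableSet_singleton k)
        exact Disjoint.preimage q (Set.disjoint_singleton.2 hkl)
      simp only [Function.comp_apply, Finset.restrict, evaluations, Φ]
      rw [h1, h3, Finset.sum_filter]
      refine Finset.sum_congr rfl fun k _ => ?_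
      rw [ofReal_measureReal]
    rw [hmap ρ₂ hfin₂ (hnull₂ N hN hN0), hmap ρ₁ hfin₁ (hnull₁ N hN hN0), h n q hq hpos]
  ext s hs
  obtain ⟨t, ht, rfl⟩ := measurableSpace_measure_le_comap_evaluations s hs
  rw [← Measure.map_apply measurable_evaluations ht, key,
    Measure.map_apply measurable_evaluations ht]

/-- A version of `ext_of_map_partition` for the joint law of a random variable and a random
measure. -/
theorem ext_prod_of_map_partition {E : Type*} [MeasurableSpace E] {H : Measure Ω} (hH : H ≠ 0)
    {m₁ m₂ : Measure (E × Measure Ω)} [IsFiniteMeasure m₁]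
    (hfin₁ : ∀ᵐ z ∂m₁, IsFiniteMeasure z.2) (hfin₂ : ∀ᵐ z ∂m₂, IsFiniteMeasure z.2)
    (hnull₁ : ∀ A, MeasurableSet A → H A = 0 → ∀ᵐ z ∂m₁, z.2 A = 0)
    (hnull₂ : ∀ A, MeasurableSet A → H A = 0 → ∀ᵐ z ∂m₂, z.2 A = 0)
    (h : ∀ (n : ℕ) (q : Ω → Fin (n + 1)), Measurable q → (∀ k, 0 < H (q ⁻¹' {k})) →
      m₁.map (fun z => (z.1, fun k => z.2.real (q ⁻¹' {k}))) =
        m₂.map (fun z => (z.1, fun k => z.2.real (q ⁻¹' {k})))) :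
    m₁ = m₂ := by
  refine Measure.ext_prod fun {s t} hs ht => ?_
  have hms : MeasurableSet (s ×ˢ (Set.univ : Set (Measure Ω))) := hs.prod MeasurableSet.univ
  have hae (m : Measure (E × Measure Ω)) {p : Measure Ω → Prop} (hp : MeasurableSet {μ | p μ})
      (hm : ∀ᵐ z ∂m, p z.2) : ∀ᵐ μ ∂(m.restrict (s ×ˢ Set.univ)).map Prod.snd, p μ :=
    (ae_map_iff measurable_snd.aemeasurable hp).2 (ae_restrict_of_ae hm)
  have hz (A : Set Ω) (hA : MeasurableSet A) : MeasurableSet {μ : Measure Ω | μ A = 0} :=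
    Measure.measurable_coe hA (measurableSet_singleton 0)
  -- Restricting the first variable to a fixed `s` reduces the joint statement to one about
  -- (unnormalized) laws of random measures.
  have key : (m₁.restrict (s ×ˢ Set.univ)).map Prod.snd =
      (m₂.restrict (s ×ˢ Set.univ)).map Prod.snd := by
    refine ext_of_map_partition hH (hae _ measurableSet_isFiniteMeasure hfin₁) (hae _ measurableSet_isFiniteMeasure hfin₂)
      (fun A hA h0 => hae _ (hz A hA) (hnull₁ A hA h0))
      (fun A hA h0 => hae _ (hz A hA) (hnull₂ A hA h0)) fun n q hq hpos => ?_
    have hqm := measurable_real_partition hq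
    have hm' (m : Measure (E × Measure Ω)) :
        ((m.restrict (s ×ˢ Set.univ)).map Prod.snd).map (fun μ k => μ.real (q ⁻¹' {k})) =
          ((m.map (fun z => (z.1, fun k => z.2.real (q ⁻¹' {k})))).restrict
            (s ×ˢ Set.univ)).map Prod.snd := by
      have hj : Measurable fun z : E × Measure Ω => (z.1, fun k => z.2.real (q ⁻¹' {k})) :=
        measurable_fst.prodMk (hqm.comp measurable_snd)
      rw [Measure.restrict_map hj (hs.prod MeasurableSet.univ), Measure.map_map hqm measurable_snd,
        Measure.map_map measurable_snd hj]
      congr 2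
    rw [hm', hm', h n q hq hpos]
  have := congrArg (fun ρ => ρ t) key
  simp only [Measure.map_apply measurable_snd ht, Measure.restrict_apply (measurable_snd ht)] at this
  convert this using 2 <;> (ext z; simp [and_comm])

end RandomMeasures

/-! ### Total mass and normalization of a gamma process. -/

section GammaProcess

variable {Ω : Type*} [MeasurableSpace Ω]

theorem measurable_normalize : Measurable (normalize : Measure Ω → Measure Ω) := by
  refine Measure.measurable_of_measurable_coe _ fun s hs => ?_
  simp only [normalize, Measure.smul_apply, smul_eq_mul]
  exact (Measure.measurable_coe MeasurableSet.univ).inv.mul (Measure.measurable_coe hs)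

theorem normalize_real_apply (μ : Measure Ω) (s : Set Ω) :
    (normalize μ).real s = μ.real s / μ.real Set.univ := by
  simp [normalize, Measure.real, ENNReal.toReal_mul, div_eq_inv_mul]

theorem isProbabilityMeasure_normalize {μ : Measure Ω} (h0 : μ Set.univ ≠ 0)
    (hfin : μ Set.univ ≠ ⊤) : IsProbabilityMeasure (normalize μ) :=
  ⟨by simp [normalize, ENNReal.inv_mul_cancel h0 hfin]⟩

theorem ofReal_smul_normalize {μ : Measure Ω} (h0 : μ Set.univ ≠ 0) (hfin : μ Set.univ ≠ ⊤) :
    ENNReal.ofReal (μ.real Set.univ) • normalize μ = μ := by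
  rw [normalize, smul_smul, Measure.real, ENNReal.ofReal_toReal hfin, ENNReal.mul_inv_cancel h0 hfin,
    one_smul]

theorem measurable_smul_measure :
    Measurable fun z : ℝ × Measure Ω => ENNReal.ofReal z.1 • z.2 := by
  refine Measure.measurable_of_measurable_coe _ fun s hs => ?_
  simp only [Measure.smul_apply, smul_eq_mul]
  exact measurable_fst.ennreal_ofReal.mul ((Measure.measurable_coe hs).comp measurable_snd)

theorem measurableSet_isProbabilityMeasure :
    MeasurableSet {μ : Measure Ω | IsProbabilityMeasure μ} := by
  simp_rw [isProbabilityMeasure_iff]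
  exact Measure.measurable_coe MeasurableSet.univ (measurableSet_singleton 1)

namespace IsGammaProcessLaw

variable {c : ℝ} {H : Measure Ω} {ρ : Measure (Measure Ω)}

theorem map_real_apply (h : IsGammaProcessLaw c H ρ) (hc : 0 < c) {A : Set Ω}
    (hA : MeasurableSet A) : ρ.map (fun μ => μ.real A) = gammaDist (H.real A) c := by
  have h1 := congrArg (fun m => m.map fun v : Fin 1 → ℝ => v 0)
    (h.fidi 1 (fun _ => A) (fun _ => hA) fun q r hqr => absurd (Subsingleton.elim q r) hqr)
  have hprob : IsProbabilityMeasure (gammaDist (H.real A) c) := by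
    unfold gammaDist
    split_ifs with h0
    · infer_instance
    · exact isProbabilityMeasure_gammaMeasure (lt_of_le_of_ne measureReal_nonneg (Ne.symm h0)) hc
  have h2 := (measurePreserving_eval (fun _ : Fin 1 => gammaDist (H.real A) c) 0).map_eq
  beta_reduce at h1
  rw [Measure.map_map (measurable_pi_apply _)
    (measurable_pi_iff.2 fun _ => measurable_real_apply hA)] at h1
  exact h1.trans h2

theorem ae_null (h : IsGammaProcessLaw c H ρ) (hc : 0 < c) {A : Set Ω} (hA : MeasurableSet A)
    (h0 : H A = 0) : ∀ᵐ μ ∂ρ, μ A = 0 := by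
  have h1 := h.map_real_apply hc hA
  rw [measureReal_def, h0, ENNReal.toReal_zero, gammaDist, if_pos rfl] at h1
  have h2 : ∀ᵐ x ∂ρ.map (fun μ => μ.real A), x = 0 := by
    rw [h1, ae_dirac_eq]
    rfl
  have h3 := ae_of_ae_map (measurable_real_apply hA).aemeasurable h2
  -- Finiteness matters: `μ.real A` is also `0` when `μ A = ⊤`.
  filter_upwards [h3, h.finite] with μ h4 h5
  simpa [measureReal_eq_zero_iff] using h4

theorem map_real_univ (h : IsGammaProcessLaw c H ρ) (hc : 0 < c) [IsFiniteMeasure H]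
    (hH : H ≠ 0) : ρ.map (fun μ => μ.real Set.univ) = gammaMeasure (H.real Set.univ) c := by
  rw [h.map_real_apply hc MeasurableSet.univ, gammaDist, if_neg (by simpa [measureReal_eq_zero_iff])]

theorem ae_pos (h : IsGammaProcessLaw c H ρ) (hc : 0 < c) [IsFiniteMeasure H]
    (hH : H ≠ 0) : ∀ᵐ μ ∂ρ, μ Set.univ ≠ 0 := by
  have h1 : ∀ᵐ x ∂gammaMeasure (H.real Set.univ) c, x ≠ 0 :=
    (withDensity_absolutelyContinuous _ _).ae_le (Measure.ae_ne volume (0 : ℝ))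
  rw [← h.map_real_univ hc hH] at h1
  filter_upwards [ae_of_ae_map (measurable_real_apply MeasurableSet.univ).aemeasurable h1]
    with μ h2 h3
  exact h2 (by simp [Measure.real, h3])

theorem ae_isProbabilityMeasure_normalize (h : IsGammaProcessLaw c H ρ) (hc : 0 < c)
    [IsFiniteMeasure H] (hH : H ≠ 0) : ∀ᵐ μ ∂ρ, IsProbabilityMeasure (normalize μ) := by
  filter_upwards [h.finite, h.ae_pos hc hH] with μ h1 h2
  exact isProbabilityMeasure_normalize h2 (measure_ne_top μ _)

/-- On a partition into sets of positive mean measure, total and proportions of a gamma process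
are independent, of gamma and Dirichlet distribution. -/
theorem map_total_proportions (h : IsGammaProcessLaw c H ρ) (hc : 0 < c) [IsFiniteMeasure H]
    {n : ℕ} {A : Fin (n + 1) → Set Ω} (hA : ∀ q, MeasurableSet (A q))
    (hd : Pairwise fun q r => Disjoint (A q) (A r)) (hU : (⋃ q, A q) = Set.univ)
    (hpos : ∀ q, 0 < H (A q)) :
    ρ.map (fun μ => (μ.real Set.univ, fun q => (normalize μ).real (A q))) =
      (gammaMeasure (H.real Set.univ) c).prod (dirichletMeasure fun q => H.real (A q)) := by
  have hsum (μ : Measure Ω) [IsFiniteMeasure μ] : μ.real Set.univ = ∑ q, μ.real (A q) := by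
    rw [← hU, measureReal_iUnion_fintype hd hA]
  have hpos' (q) : 0 < H.real (A q) := by
    rw [measureReal_def]
    exact ENNReal.toReal_pos (hpos q).ne' (measure_ne_top _ _)
  have hm : Measurable fun (μ : Measure Ω) q => μ.real (A q) :=
    measurable_pi_iff.2 fun q => measurable_real_apply (hA q)
  have h1 := h.fidi (n + 1) A hA hd
  simp only [gammaDist, (hpos' _).ne', if_false] at h1
  rw [hsum H, ← pi_gammaMeasure_map_total_proportions hpos' hc, ← h1,
    Measure.map_map (by fun_prop) hm]
  refine Measure.map_congr ?_
  filter_upwards [h.finite] with μ hμ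
  simp [normalize_real_apply, hsum μ]

/-- A normalized gamma process is a Dirichlet process. -/
theorem isDirichletProcessLaw_normalize (h : IsGammaProcessLaw c H ρ) (hc : 0 < c)
    [IsFiniteMeasure H] (hH : H ≠ 0) :
    IsDirichletProcessLaw (H.real Set.univ) (normalize H) (ρ.map normalize) := by
  have := h.prob
  have hr : H.real Set.univ ≠ 0 := by simpa [measureReal_eq_zero_iff]
  have hHU : H Set.univ ≠ 0 := by simpa
  have hnH (A : Set Ω) : normalize H A = 0 ↔ H A = 0 := by
    simp [normalize, measure_ne_top]
  refine ⟨Measure.isProbabilityMeasure_map measurable_normalize.aemeasurable, ?_, ?_, ?_⟩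
  · rw [ae_map_iff measurable_normalize.aemeasurable measurableSet_isProbabilityMeasure]
    exact h.ae_isProbabilityMeasure_normalize hc hH
  · intro A hA h0
    refine (ae_map_iff measurable_normalize.aemeasurable
      (Measure.measurable_coe hA (measurableSet_singleton 0))).2 ?_
    filter_upwards [h.ae_null hc hA ((hnH A).1 h0)] with μ hμ
    simp [normalize, hμ]
  · intro n A hA hd hU hpos
    have hpos' (q) : 0 < H (A q) := pos_iff_ne_zero.2 fun h0 => (hpos q).ne' ((hnH _).2 h0)
    have hm : Measurable fun (μ : Measure Ω) q => μ.real (A q) :=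
      measurable_pi_iff.2 fun q => measurable_real_apply (hA q)
    have h1 := congrArg (fun m => m.map Prod.snd) (h.map_total_proportions hc hA hd hU hpos')
    have : IsProbabilityMeasure (gammaMeasure (H.real Set.univ) c) :=
      isProbabilityMeasure_gammaMeasure (lt_of_le_of_ne measureReal_nonneg hr.symm) hc
    beta_reduce at h1
    rw [Measure.map_map measurable_snd (by exact
      (measurable_real_apply MeasurableSet.univ).prodMk (hm.comp measurable_normalize)), Measure.map_snd_prod, measure_univ, one_smul] at h1
    rw [Measure.map_map hm measurable_normalize]
    refine Eq.trans h1 (congrArg dirichletMeasure (funext fun q => ?_))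
    -- The concentration `H(Ω)` times the normalized mass is `H(A q)`, the shape of the gamma mass
    -- of the cell.
    rw [normalize_real_apply, mul_div_cancel₀ _ hr]

/-- The total mass and the normalization of a gamma process are independent. -/
theorem map_total_normalize (h : IsGammaProcessLaw c H ρ) (hc : 0 < c) [IsFiniteMeasure H]
    (hH : H ≠ 0) :
    ρ.map (fun μ => (μ.real Set.univ, normalize μ)) =
      (ρ.map fun μ => μ.real Set.univ).prod (ρ.map normalize) := by
  have := h.prob
  have hDP := h.isDirichletProcessLaw_normalize hc hH
  have := hDP.prob
  have hu : Measurable fun μ : Measure Ω => μ.real Set.univ :=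
    measurable_real_apply MeasurableSet.univ
  have hj : Measurable fun μ : Measure Ω => (μ.real Set.univ, normalize μ) :=
    hu.prodMk measurable_normalize
  have hnH (A : Set Ω) (h0 : H A = 0) : normalize H A = 0 := by simp [normalize, h0]
  have hz {A : Set Ω} (hA : MeasurableSet A) : MeasurableSet {μ : Measure Ω | μ A = 0} :=
    Measure.measurable_coe hA (measurableSet_singleton 0)
  have : IsProbabilityMeasure (ρ.map fun μ => μ.real Set.univ) :=
    Measure.isProbabilityMeasure_map hu.aemeasurable
  have hfin : ∀ᵐ μ ∂ρ.map normalize, IsFiniteMeasure μ := by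
    filter_upwards [hDP.prob_ae] with μ hμ
    infer_instance
  have hsnd₁ {p : Measure Ω → Prop} (hp : MeasurableSet {μ | p μ}) (hae : ∀ᵐ μ ∂ρ.map normalize, p μ) :
      ∀ᵐ z ∂ρ.map (fun μ => (μ.real Set.univ, normalize μ)), p z.2 := by
    refine (ae_map_iff hj.aemeasurable (measurable_snd hp)).2 ?_
    exact (ae_map_iff measurable_normalize.aemeasurable hp).1 hae
  have hsnd₂ {p : Measure Ω → Prop} (hae : ∀ᵐ μ ∂ρ.map normalize, p μ) :
      ∀ᵐ z ∂(ρ.map fun μ => μ.real Set.univ).prod (ρ.map normalize), p z.2 :=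
    Measure.quasiMeasurePreserving_snd.ae hae
  -- It suffices to compare the total together with the proportions on a positive partition, and
  -- there the finite-dimensional factorization applies.
  refine ext_prod_of_map_partition hH (hsnd₁ measurableSet_isFiniteMeasure hfin) (hsnd₂ hfin)
    (fun A hA h0 => hsnd₁ (hz hA) (hDP.null A hA (hnH A h0)))
    (fun A hA h0 => hsnd₂ (hDP.null A hA (hnH A h0))) fun n q hq hpos => ?_
  have hqm := measurable_real_partition hq
  have hA (k) : MeasurableSet (q ⁻¹' {k}) := hq (measurableSet_singleton k)
  have hd : Pairwise fun k l => Disjoint (q ⁻¹' {k}) (q ⁻¹' {l}) := fun k l hkl =>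
    Disjoint.preimage q (Set.disjoint_singleton.2 hkl)
  have hU : (⋃ k, q ⁻¹' {k}) = Set.univ := by ext; simp
  have h1 := h.map_total_proportions hc hA hd hU hpos
  have h2 := hDP.fidi n _ hA hd hU fun k => by
    simpa [normalize, pos_iff_ne_zero, measure_ne_top] using (hpos k).ne'
  have hr : H.real Set.univ ≠ 0 := by simpa [measureReal_eq_zero_iff]
  simp only [normalize_real_apply, mul_div_cancel₀ _ hr] at h2
  have h3 : (fun z : ℝ × Measure Ω => (z.1, fun k => z.2.real (q ⁻¹' {k}))) =
      Prod.map id fun μ k => μ.real (q ⁻¹' {k}) := rfl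
  rw [Measure.map_map (by rw [h3]; exact measurable_id.prodMap hqm) hj]
  refine Eq.trans h1 ?_
  rw [h3, ← Measure.map_prod_map _ _ measurable_id hqm, Measure.map_id, h2, h.map_real_univ hc hH]

end IsGammaProcessLaw

end GammaProcess

/-! ### Occupation counts of finite sequences. -/

section Counts

variable {ι : Type*} [DecidableEq ι]

/-- The number of indices at which a finite sequence takes each value. -/
def counts {n : ℕ} (f : Fin n → ι) (k : ι) : ℕ := (Finset.univ.filter fun i => f i = k).card

theorem sum_counts [Fintype ι] {n : ℕ} (f : Fin n → ι) : ∑ k, counts f k = n := by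
  simpa [counts] using (Finset.card_eq_sum_card_fiberwise (s := Finset.univ) (t := Finset.univ) (f := f)
    fun _ _ => Finset.mem_coe.2 (Finset.mem_univ _)).symm

theorem prod_comp_eq_prod_pow_counts [Fintype ι] {M : Type*} [CommMonoid M] {n : ℕ} (f : Fin n → ι)
    (g : ι → M) : ∏ i, g (f i) = ∏ k, g k ^ counts f k := by
  rw [← Finset.prod_fiberwise Finset.univ f]
  refine Finset.prod_congr rfl fun k _ => ?_
  rw [counts, Finset.prod_congr rfl (g := fun _ => g k), Finset.prod_const]
  intro i hi
  rw [(Finset.mem_filter.1 hi).2]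

/-- The number of finite sequences with given counts is a multinomial coefficient. -/
theorem card_filter_counts_eq [Fintype ι] (k : ι → ℕ) :
    (Finset.univ.filter fun f : Fin (∑ c, k c) → ι => counts f = k).card =
      Nat.multinomial Finset.univ k := by
  have hmon (k : ι → ℕ) : (∏ c, MvPolynomial.X c ^ k c : MvPolynomial ι ℕ) =
      MvPolynomial.monomial (Finsupp.equivFunOnFinite.symm k) 1 := by
    rw [MvPolynomial.monomial_eq, Finsupp.prod_fintype _ _ (by simp)]
    simp
  -- A power of the sum of all variables is expanded once over sequences and once by the multinomial
  -- theorem; the coefficient of the monomial with exponents `k` gives the count.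
  have h1 := Fintype.sum_pow (fun c : ι => (MvPolynomial.X c : MvPolynomial ι ℕ)) (∑ c, k c)
  rw [Finset.sum_pow_eq_sum_piAntidiag] at h1
  have h2 := congrArg (MvPolynomial.coeff (Finsupp.equivFunOnFinite.symm k)) h1
  simp only [prod_comp_eq_prod_pow_counts, hmon, MvPolynomial.coeff_sum,
    MvPolynomial.coeff_monomial] at h2
  rw [Finset.card_filter]
  simp only [EmbeddingLike.apply_eq_iff_eq] at h2
  rw [← h2]
  simp only [← map_natCast (MvPolynomial.C : ℕ →+* MvPolynomial ι ℕ), MvPolynomial.coeff_C_mul,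
    MvPolynomial.coeff_monomial, EmbeddingLike.apply_eq_iff_eq]
  simp

/-- Finite sequences with the same counts agree up to a permutation. -/
theorem exists_perm_of_counts_eq {n : ℕ} {f g : Fin n → ι} (h : counts f = counts g) :
    ∃ σ : Equiv.Perm (Fin n), f = g ∘ σ := by
  -- Equal counts give bijections between the fibres over each value, which glue to a permutation.
  have e (c : ι) : {i // f i = c} ≃ {i // g i = c} := by
    refine Fintype.equivOfCardEq ?_
    rw [Fintype.card_subtype, Fintype.card_subtype]
    exact congrFun h c
  refine ⟨(Equiv.sigmaFiberEquiv f).symm.trans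
    ((Equiv.sigmaCongrRight e).trans (Equiv.sigmaFiberEquiv g)), ?_⟩
  ext i
  exact ((e (f i) ⟨i, rfl⟩).2).symm

end Counts

/-! ### Random lists of points and their counting measures. -/

section Points

variable {Ω : Type*} [MeasurableSpace Ω]

theorem measurable_sigma_mk (n : ℕ) : Measurable fun y : Fin n → Ω => (⟨n, y⟩ : Points Ω) :=
  fun _ hs => MeasurableSpace.measurableSet_iInf.1 hs n

/-- The σ-algebra on lists is the finest one that makes the inclusion of each fixed length
measurable, so one length at a time suffices. -/
theorem measurable_of_sigma {E : Type*} [MeasurableSpace E] {f : Points Ω → E}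
    (hf : ∀ n, Measurable fun y : Fin n → Ω => f ⟨n, y⟩) : Measurable f :=
  fun _ hs => MeasurableSpace.measurableSet_iInf.2 fun n => hf n hs

theorem measurable_length : Measurable fun x : Points Ω => x.1 :=
  measurable_of_sigma fun _ => measurable_const

theorem measurable_reorder (τ : ∀ n : ℕ, Equiv.Perm (Fin n)) :
    Measurable (reorder τ : Points Ω → Points Ω) :=
  measurable_of_sigma fun n => (measurable_sigma_mk n).comp
    (measurable_pi_iff.2 fun i => measurable_pi_apply (τ n i))

theorem counting_apply (x : Points Ω) {s : Set Ω} (hs : MeasurableSet s) :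
    counting x s = ∑ i, s.indicator 1 (x.2 i) := by
  rw [counting, Measure.finsetSum_apply]
  exact Finset.sum_congr rfl fun i _ => Measure.dirac_apply' _ hs

theorem measurable_counting : Measurable (counting : Points Ω → Measure Ω) := by
  refine Measure.measurable_of_measurable_coe _ fun s hs => ?_
  simp_rw [counting_apply _ hs]
  refine measurable_of_sigma fun n => ?_
  change Measurable fun y : Fin n → Ω => ∑ i : Fin n, s.indicator 1 (y i)
  refine Finset.measurable_sum _ fun i _ => ?_
  exact (measurable_one.indicator hs).comp (measurable_pi_apply i)

instance (x : Points Ω) : IsFiniteMeasure (counting x) := by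
  unfold counting
  infer_instance

theorem counting_univ (x : Points Ω) : counting x Set.univ = x.1 := by
  simp [counting_apply x MeasurableSet.univ]

theorem counting_preimage {ι : Type*} [DecidableEq ι] [MeasurableSpace ι]
    [MeasurableSingletonClass ι] {q : Ω → ι} (hq : Measurable q) (x : Points Ω) (k : ι) :
    counting x (q ⁻¹' {k}) = counts (q ∘ x.2) k := by
  rw [counting_apply _ (hq (measurableSet_singleton k)), counts, Finset.card_filter]
  push_cast
  refine Finset.sum_congr rfl fun i _ => ?_
  by_cases h : q (x.2 i) = k <;> simp [h]

open Classical in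
/-- The Markov kernel that draws a point from a probability measure. -/
def pointKernel (Ω : Type*) [MeasurableSpace Ω] [Nonempty Ω] : Kernel (Measure Ω) Ω where
  -- The default Dirac mass makes the kernel Markov everywhere; only its values at probability
  -- measures matter.
  toFun μ := if IsProbabilityMeasure μ then μ else Measure.dirac (Classical.arbitrary Ω)
  measurable' := Measurable.ite measurableSet_isProbabilityMeasure measurable_id measurable_const

theorem pointKernel_apply [Nonempty Ω] (μ : Measure Ω) [h : IsProbabilityMeasure μ] :
    pointKernel Ω μ = μ := if_pos h

instance [Nonempty Ω] : IsMarkovKernel (pointKernel Ω) := ⟨fun μ => by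
  by_cases h : IsProbabilityMeasure μ
  · rwa [pointKernel_apply]
  · rw [show pointKernel Ω μ = Measure.dirac (Classical.arbitrary Ω) from if_neg h]
    infer_instance⟩

/-- The Markov kernel that draws a given number of independent points from a probability
measure. -/
def iidKernel (Ω : Type*) [MeasurableSpace Ω] [Nonempty Ω] : Kernel (ℕ × Measure Ω) (Points Ω) where
  toFun z := iidPoints z.1 (pointKernel Ω z.2)
  measurable' := measurable_from_prod_countable_right fun n =>
    (Measure.measurable_map _ (measurable_sigma_mk n)).comp
      (piKernel fun _ : Fin n => pointKernel Ω).measurable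

theorem iidKernel_apply [Nonempty Ω] (n : ℕ) (μ : Measure Ω) :
    iidKernel Ω (n, μ) = iidPoints n (pointKernel Ω μ) := rfl

theorem isProbabilityMeasure_iidPoints (n : ℕ) (μ : Measure Ω) [IsProbabilityMeasure μ] :
    IsProbabilityMeasure (iidPoints n μ) :=
  Measure.isProbabilityMeasure_map (measurable_sigma_mk n).aemeasurable

instance [Nonempty Ω] : IsMarkovKernel (iidKernel Ω) :=
  ⟨fun _ => isProbabilityMeasure_iidPoints _ _⟩

theorem ae_length_iidPoints (n : ℕ) (μ : Measure Ω) : ∀ᵐ x ∂iidPoints n μ, x.1 = n :=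
  (ae_map_iff (measurable_sigma_mk n).aemeasurable
    (measurable_length (measurableSet_singleton n))).2 (Filter.Eventually.of_forall fun _ => rfl)

theorem iidPoints_map_reorder (n : ℕ) (μ : Measure Ω) [IsProbabilityMeasure μ]
    (τ : ∀ n : ℕ, Equiv.Perm (Fin n)) : (iidPoints n μ).map (reorder τ) = iidPoints n μ := by
  have h := (measurePreserving_piCongrLeft (fun _ : Fin n => μ) (τ n).symm).map_eq
  have hm : Measurable fun (y : Fin n → Ω) i => y (τ n i) :=
    measurable_pi_iff.2 fun i => measurable_pi_apply (τ n i)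
  have h' : (Measure.pi fun _ : Fin n => μ).map (fun y i => y (τ n i)) =
      Measure.pi fun _ : Fin n => μ := by
    refine Eq.trans (congrArg (fun f => Measure.map f _) ?_) h
    ext y i
    obtain ⟨j, rfl⟩ := (τ n).symm.surjective i
    rw [MeasurableEquiv.coe_piCongrLeft, Equiv.piCongrLeft_apply_apply]
    simp
  rw [iidPoints, Measure.map_map (measurable_reorder τ) (measurable_sigma_mk n)]
  conv_rhs => rw [← h', Measure.map_map (measurable_sigma_mk n) hm]
  rfl

end Points

/-! ### A Poisson process as a Poisson number of independent points. -/

section PoissonProcess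

variable {Ω : Type*} [MeasurableSpace Ω]

/-- A Poisson number, of mean `μ(Ω)`, together with that many independent points drawn from the
normalization of `μ`. -/
def poissonPoints [Nonempty Ω] (μ : Measure Ω) : Measure (ℕ × Points Ω) :=
  poissonMeasure (μ.real Set.univ).toNNReal ⊗ₘ
    (iidKernel Ω).comap (fun n => (n, normalize μ)) measurable_prodMk_right

instance [Nonempty Ω] (μ : Measure Ω) : IsProbabilityMeasure (poissonPoints μ) := by
  unfold poissonPoints
  infer_instance

theorem poissonPoints_map_snd_apply [Nonempty Ω] (μ : Measure Ω) {s : Set (Points Ω)} (hs : MeasurableSet s) :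
    (poissonPoints μ).snd s = ∑' n : ℕ, poissonMeasure (μ.real Set.univ).toNNReal {n} *
      iidPoints n (pointKernel Ω (normalize μ)) s := by
  rw [poissonPoints, Measure.snd_apply hs, Measure.compProd_apply (measurable_snd hs),
    lintegral_countable']
  refine tsum_congr fun n => ?_
  rw [mul_comm, Kernel.comap_apply, iidKernel_apply]
  rfl

/-- The event is a disjoint union over label sequences with counts `k`; all of them have the same
probability and their number is multinomial. Any other length is incompatible with these counts. -/
theorem iidPoints_counts_eq {K : ℕ} {q : Ω → Fin K} (hq : Measurable q) (ν : Measure Ω)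
    [IsProbabilityMeasure ν] (n : ℕ) (k : Fin K → ℕ) :
    iidPoints n ν {x | counts (q ∘ x.2) = k} =
      if n = ∑ c, k c then
        Nat.multinomial Finset.univ k * ∏ c, ν (q ⁻¹' {c}) ^ k c else 0 := by
  have hms : MeasurableSet {x : Points Ω | counts (q ∘ x.2) = k} := by
    refine MeasurableSpace.measurableSet_iInf.2 fun n => ?_
    have h1 : Measurable fun (y : Fin n → Ω) i => q (y i) :=
      measurable_pi_iff.2 fun i => hq.comp (measurable_pi_apply i)
    exact h1 (Set.to_countable {f : Fin n → Fin K | counts f = k}).measurableSet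
  rw [iidPoints, Measure.map_apply (measurable_sigma_mk n) hms]
  split_ifs with hn
  · subst hn
    have h1 : (fun y => (⟨_, y⟩ : Points Ω)) ⁻¹' {x : Points Ω | counts (q ∘ x.2) = k} =
        ⋃ f ∈ Finset.univ.filter (fun f : Fin (∑ c, k c) → Fin K => counts f = k),
          Set.univ.pi fun i => q ⁻¹' {f i} := by
      ext y
      simp only [Set.mem_preimage, Set.mem_ofPred_eq, Finset.mem_filter, Finset.mem_univ, true_and,
        Set.mem_iUnion, Set.mem_pi, Set.mem_singleton_iff, exists_prop]
      constructor
      · intro h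
        exact ⟨q ∘ y, h, fun i _ => rfl⟩
      · rintro ⟨f, hf, h⟩
        rwa [show q ∘ y = f from funext fun i => h i (Set.mem_univ i)]
    rw [h1, measure_biUnion_finset]
    · simp_rw [Measure.pi_pi, fun f : Fin (∑ c, k c) → Fin K =>
        prod_comp_eq_prod_pow_counts f fun c => ν (q ⁻¹' {c})]
      rw [Finset.sum_congr rfl (g := fun _ => ∏ c, ν (q ⁻¹' {c}) ^ k c)
        fun f hf => by rw [(Finset.mem_filter.1 hf).2], Finset.sum_const,
        card_filter_counts_eq, nsmul_eq_mul]
    · intro f _ g _ hfg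
      refine Set.disjoint_left.2 fun y hy hy' => hfg (funext fun i => ?_)
      exact (hy i (Set.mem_univ i)).symm.trans (hy' i (Set.mem_univ i))
    · intro f _
      exact MeasurableSet.univ_pi fun i => hq (measurableSet_singleton _)
  · rw [show (fun y => (⟨n, y⟩ : Points Ω)) ⁻¹' {x : Points Ω | counts (q ∘ x.2) = k} = ∅ from ?_,
      measure_empty]
    ext y
    simp only [Set.mem_preimage, Set.mem_ofPred_eq, Set.mem_empty_iff_false, iff_false]
    intro h
    refine hn ?_
    rw [← h, sum_counts]

theorem measurable_counts {K : ℕ} {q : Ω → Fin K} (hq : Measurable q) :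
    Measurable fun x : Points Ω => counts (q ∘ x.2) := by
  refine measurable_of_sigma fun n => ?_
  have h1 : Measurable fun (y : Fin n → Ω) i => q (y i) :=
    measurable_pi_iff.2 fun i => hq.comp (measurable_pi_apply i)
  exact (measurable_of_countable (counts : (Fin n → Fin K) → _)).comp h1

/-- The counts of a Poisson number of independent points in the cells of a partition are
independent Poisson variables. -/
theorem poissonPoints_map_counts [Nonempty Ω] {K : ℕ} {q : Ω → Fin K} (hq : Measurable q) (μ : Measure Ω)
    [IsFiniteMeasure μ] (h0 : μ ≠ 0) :
    (poissonPoints μ).snd.map (fun x => counts (q ∘ x.2)) =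
      Measure.pi fun k => poissonMeasure (μ.real (q ⁻¹' {k})).toNNReal := by
  have := isProbabilityMeasure_normalize (μ := μ) (by simpa) (measure_ne_top _ _)
  have hT : μ.real Set.univ ≠ 0 := by simpa [measureReal_eq_zero_iff]
  refine Measure.ext_of_singleton fun k => ?_
  have hms := measurable_counts hq (measurableSet_singleton k)
  rw [Measure.map_apply (measurable_counts hq) (measurableSet_singleton k),
    poissonPoints_map_snd_apply _ hms, pointKernel_apply]
  have h1 (n : ℕ) := iidPoints_counts_eq hq (normalize μ) n k
  have h2 : (fun x : Points Ω => counts (q ∘ x.2)) ⁻¹' {k} = {x | counts (q ∘ x.2) = k} := rfl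
  simp_rw [h2, h1]
  -- The counts force the number of points, so the mixture over Poisson numbers has a single nonzero
  -- term.
  rw [tsum_eq_single (∑ c, k c) (fun n hn => by rw [if_neg hn, mul_zero]), if_pos rfl,
    Measure.pi_singleton]
  simp_rw [poissonMeasure_singleton]
  have hν (c) : normalize μ (q ⁻¹' {c}) =
      ENNReal.ofReal (μ.real (q ⁻¹' {c}) / μ.real Set.univ) := by
    rw [← normalize_real_apply, ofReal_measureReal]
  simp_rw [hν]
  have hsum : μ.real Set.univ = ∑ c, μ.real (q ⁻¹' {c}) := by
    rw [← measureReal_iUnion_fintype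
      (fun k l hkl => Disjoint.preimage q (Set.disjoint_singleton.2 hkl))
      fun c => hq (measurableSet_singleton c)]
    congr 1
    ext; simp
  rw [← ENNReal.ofReal_natCast]
  simp_rw [← ENNReal.ofReal_pow (div_nonneg measureReal_nonneg measureReal_nonneg)]
  rw [← ENNReal.ofReal_prod_of_nonneg (fun c _ => by positivity),
    ← ENNReal.ofReal_mul (by positivity), ← ENNReal.ofReal_mul (by positivity),
    ← ENNReal.ofReal_prod_of_nonneg (fun c _ => by positivity)]
  congr 1
  simp only [Real.coe_toNNReal _ measureReal_nonneg]
  -- The factorial of the total in the Poisson weight cancels against the multinomial coefficient,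
  -- powers of the total mass cancel against the normalization, and the exponential splits by
  -- additivity of `μ`.
  have hspec := congrArg (Nat.cast : ℕ → ℝ) (Nat.multinomial_spec Finset.univ k)
  push_cast at hspec
  simp only [div_pow, Finset.prod_div_distrib, Finset.prod_mul_distrib]
  rw [Finset.prod_pow_eq_pow_sum, ← Real.exp_sum, ← hspec, Finset.sum_neg_distrib, ← hsum]
  have hf : (∏ c, ((k c).factorial : ℝ)) ≠ 0 :=
    Finset.prod_ne_zero_iff.2 fun c _ => by positivity
  have hm : (Nat.multinomial Finset.univ k : ℝ) ≠ 0 := by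
    exact_mod_cast (Nat.multinomial_pos _ _).ne'
  field_simp

/-- Almost surely none of the draws falls into a null set. This supplies the null-set condition of
`ext_of_map_partition`. -/
theorem ae_counting_null [Nonempty Ω] (μ : Measure Ω) [IsFiniteMeasure μ] (h0 : μ ≠ 0) {A : Set Ω}
    (hA : MeasurableSet A) (hA0 : μ A = 0) : ∀ᵐ x ∂(poissonPoints μ).snd, counting x A = 0 := by
  have := isProbabilityMeasure_normalize (μ := μ) (by simpa) (measure_ne_top _ _)
  have hms : MeasurableSet {x : Points Ω | counting x A = 0} :=
    ((Measure.measurable_coe hA).comp measurable_counting) (measurableSet_singleton 0)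
  rw [ae_iff]
  change (poissonPoints μ).snd {x | counting x A = 0}ᶜ = 0
  rw [poissonPoints_map_snd_apply _ hms.compl, pointKernel_apply]
  refine ENNReal.tsum_eq_zero.2 fun n => mul_eq_zero_of_right _ ?_
  rw [iidPoints, Measure.map_apply (measurable_sigma_mk n) hms.compl]
  have h1 : ∀ᵐ y ∂Measure.pi fun _ : Fin n => normalize μ, ∀ i, y i ∉ A := by
    rw [ae_all_iff]
    intro i
    refine Measure.tendsto_eval_ae_ae.eventually (measure_eq_zero_iff_ae_notMem.1 ?_)
    simp [normalize, hA0]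
  refine measure_mono_null (fun y hy => ?_) (ae_iff.1 h1)
  refine fun hcon => hy ?_
  change counting _ A = 0
  rw [counting_apply _ hA]
  exact Finset.sum_eq_zero fun i _ => Set.indicator_of_notMem (hcon i) _

theorem IsPoissonProcessLaw.map_real_apply {H : Measure Ω} {ρ : Measure (Measure Ω)}
    (h : IsPoissonProcessLaw H ρ) {A : Set Ω} (hA : MeasurableSet A) :
    ρ.map (fun μ => μ.real A) =
      (poissonMeasure (H.real A).toNNReal).map (fun n : ℕ => (n : ℝ)) := by
  have h1 := congrArg (fun m => m.map fun v : Fin 1 → ℝ => v 0)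
    (h.fidi 1 (fun _ => A) (fun _ => hA) fun q r hqr => absurd (Subsingleton.elim q r) hqr)
  have h2 := (measurePreserving_eval (fun _ : Fin 1 =>
    (poissonMeasure (H.real A).toNNReal).map (fun n : ℕ => (n : ℝ))) 0).map_eq
  beta_reduce at h1
  rw [Measure.map_map (measurable_pi_apply _)
    (measurable_pi_iff.2 fun _ => measurable_real_apply hA)] at h1
  exact h1.trans h2

/-- A Poisson process with finite nonzero mean measure consists of a Poisson number of independent
points. -/
theorem IsPoissonProcessLaw.eq_map_counting [Nonempty Ω] {H : Measure Ω} [IsFiniteMeasure H] (hH : H ≠ 0)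
    {ρ : Measure (Measure Ω)} (h : IsPoissonProcessLaw H ρ) :
    ρ = (poissonPoints H).snd.map counting := by
  have := h.prob
  refine ext_of_map_partition hH h.finite ?_ (fun A hA h0 => ?_) (fun A hA h0 => ?_)
    fun n q hq _ => ?_
  · refine (ae_map_iff measurable_counting.aemeasurable measurableSet_isFiniteMeasure).2 ?_
    exact Filter.Eventually.of_forall fun x => inferInstance
  · have h1 := h.map_real_apply hA
    have h2 : ∀ᵐ x ∂ρ.map (fun μ => μ.real A), x = 0 := by
      rw [h1]
      rw [ae_map_iff (measurable_of_countable _).aemeasurable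
        (by exact measurableSet_singleton (0 : ℝ))]
      rw [measureReal_def, h0, ENNReal.toReal_zero, Real.toNNReal_zero, ae_iff]
      refine (measure_null_iff_singleton (Set.to_countable _)).2 fun n hn => ?_
      rw [poissonMeasure_singleton]
      have : n ≠ 0 := fun h => hn (by simp [h])
      simp [this]
    filter_upwards [ae_of_ae_map (measurable_real_apply hA).aemeasurable h2, h.finite] with μ h3 h4
    simpa [measureReal_eq_zero_iff] using h3
  · exact (ae_map_iff measurable_counting.aemeasurable
      (Measure.measurable_coe hA (measurableSet_singleton 0))).2 (ae_counting_null H hH hA h0)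
  · rw [h.fidi (n + 1) (fun k => q ⁻¹' {k}) (fun k => hq (measurableSet_singleton k))
      (fun k l hkl => Disjoint.preimage q (Set.disjoint_singleton.2 hkl)),
      ← Measure.pi_map_pi (fun k => (measurable_of_countable _).aemeasurable),
      ← poissonPoints_map_counts hq H hH, Measure.map_map (measurable_of_countable _)
        (measurable_counts hq), Measure.map_map (measurable_real_partition hq) measurable_counting]
    congr 1
    ext x k
    simp [Measure.real, counting_preimage hq]

end PoissonProcess

/-! ### Exchangeable lists are determined by their counting measures. -/

section Exchangeable

variable {Ω : Type*} [MeasurableSpace Ω]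

/-- The list of the images of the points of a list. -/
def mapPoints {Ω D : Type*} (q : Ω → D) (x : Points Ω) : Points D := ⟨x.1, q ∘ x.2⟩

theorem measurableSet_mapPoints_eq {D : Type*} [Countable D] [MeasurableSpace D]
    [MeasurableSingletonClass D] {q : Ω → D} (hq : Measurable q) (y : Points D) :
    MeasurableSet {x : Points Ω | mapPoints q x = y} := by
  obtain ⟨n, f⟩ := y
  refine MeasurableSpace.measurableSet_iInf.2 fun k => ?_
  change MeasurableSet {w : Fin k → Ω | (⟨k, q ∘ w⟩ : Points D) = ⟨n, f⟩}
  by_cases h : k = n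
  · subst h
    simp only [Sigma.mk.injEq, heq_eq_eq, true_and]
    have h1 : Measurable fun w : Fin k → Ω => q ∘ w :=
      measurable_pi_iff.2 fun i => hq.comp (measurable_pi_apply i)
    exact h1 (measurableSet_singleton f)
  · convert MeasurableSet.empty
    simp [h]

/-- A reordering that acts by `σ` on lists of length `n` and trivially on other lengths pulls the
cell of `f ∘ σ` back to the cell of `f`; invariance then gives both cells equal mass. -/
theorem mapPoints_reorder_update {Ω D : Type*} (q : Ω → D) {n : ℕ} (σ : Equiv.Perm (Fin n))
    (f : Fin n → D) (x : Points Ω) :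
    mapPoints q (reorder (Function.update (fun _ => Equiv.refl _) n σ) x) = ⟨n, f ∘ σ⟩ ↔
      mapPoints q x = ⟨n, f⟩ := by
  obtain ⟨k, w⟩ := x
  by_cases h : k = n
  · subst h
    simp only [mapPoints, reorder, Function.update_self, Sigma.mk.injEq, heq_eq_eq, true_and]
    exact (Equiv.surjective σ).injective_comp_right.eq_iff (a := q ∘ w) (b := f)
  · simp [mapPoints, reorder, h]

/-- The cell of families of lists of given lengths whose points fall into given classes. -/
def listCell {Ω J D : Type*} (q : Ω → D) {n : J → ℕ} (y : (Σ j, Fin (n j)) → D) :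
    Set (J → Points Ω) :=
  {x | ∀ j, mapPoints q (x j) = ⟨n j, fun i => y ⟨j, i⟩⟩}

theorem disjoint_listCell {Ω J D : Type*} (q : Ω → D) {n : J → ℕ} {y y' : (Σ j, Fin (n j)) → D}
    (h : y ≠ y') : Disjoint (listCell q y) (listCell q y') := by
  refine Set.disjoint_left.2 fun x hx hx' => h (funext fun p => ?_)
  have h1 := (hx p.1).symm.trans (hx' p.1)
  simp only [Sigma.mk.injEq, heq_eq_eq, true_and] at h1
  exact congrFun h1 p.2

variable {J : Type*} [Fintype J]

theorem measurableSet_listCell {D : Type*} [Countable D] [MeasurableSpace D]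
    [MeasurableSingletonClass D] {q : Ω → D} (hq : Measurable q) {n : J → ℕ}
    (y : (Σ j, Fin (n j)) → D) : MeasurableSet (listCell q y) := by
  have : listCell q y = Set.univ.pi fun j =>
      {x : Points Ω | mapPoints q x = ⟨n j, fun i => y ⟨j, i⟩⟩} := by
    ext x
    simp [listCell, Set.mem_pi]
  rw [this]
  exact MeasurableSet.univ_pi fun j => measurableSet_mapPoints_eq hq _

open Classical in
/-- For a law that is invariant under reordering, the mass of a cell is determined by the law of the
counting measures. -/
theorem card_mul_measure_listCell {D : Type*} [Fintype D] [MeasurableSpace D]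
    [MeasurableSingletonClass D] {q : Ω → D} (hq : Measurable q) {n : J → ℕ}
    (y : (Σ j, Fin (n j)) → D) {m : Measure (J → Points Ω)}
    (hm : ∀ τ : J → ∀ n : ℕ, Equiv.Perm (Fin n), m.map (fun x j => reorder (τ j) (x j)) = m) :
    ((Finset.univ.filter fun y' : (Σ j, Fin (n j)) → D =>
        ∀ j, counts (fun i => y' ⟨j, i⟩) = counts fun i => y ⟨j, i⟩).card : ENNReal) *
        m (listCell q y) =
      m.map (fun x j => counting (x j))
        {μ | ∀ j k, μ j (q ⁻¹' {k}) = (counts (fun i => y ⟨j, i⟩) k : ENNReal)} := by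
  have hcm : Measurable fun (x : J → Points Ω) j => counting (x j) :=
    measurable_pi_iff.2 fun j => measurable_counting.comp (measurable_pi_apply j)
  have hset : MeasurableSet {μ : J → Measure Ω |
      ∀ j k, μ j (q ⁻¹' {k}) = (counts (fun i => y ⟨j, i⟩) k : ENNReal)} := by
    have : {μ : J → Measure Ω |
      ∀ j k, μ j (q ⁻¹' {k}) = (counts (fun i => y ⟨j, i⟩) k : ENNReal)} =
        ⋂ j, ⋂ k, (fun μ : J → Measure Ω => μ j (q ⁻¹' {k})) ⁻¹'
          {(counts (fun i => y ⟨j, i⟩) k : ENNReal)} := by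
      ext μ; simp
    rw [this]
    exact MeasurableSet.iInter fun j => MeasurableSet.iInter fun k =>
      ((Measure.measurable_coe (hq (measurableSet_singleton k))).comp (measurable_pi_apply j))
        (measurableSet_singleton _)
  rw [Measure.map_apply hcm hset]
  -- Prescribing all counts allows exactly the labelings with the counts of `y`. Lengths need not be
  -- prescribed: they are sums of counts.
  have hU : (fun (x : J → Points Ω) j => counting (x j)) ⁻¹' {μ : J → Measure Ω |
      ∀ j k, μ j (q ⁻¹' {k}) = (counts (fun i => y ⟨j, i⟩) k : ENNReal)} =
      ⋃ y' ∈ Finset.univ.filter (fun y' : (Σ j, Fin (n j)) → D =>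
        ∀ j, counts (fun i => y' ⟨j, i⟩) = counts fun i => y ⟨j, i⟩), listCell q y' := by
    ext x
    simp only [Set.mem_preimage, Set.mem_ofPred_eq, counting_preimage hq, Nat.cast_inj,
      Finset.mem_filter, Finset.mem_univ, true_and, Set.mem_iUnion, exists_prop]
    constructor
    · intro h
      have hlen (j) : (x j).1 = n j := by
        have h1 := sum_counts (q ∘ (x j).2)
        rw [Finset.sum_congr rfl fun k _ => h j k, sum_counts] at h1
        exact h1.symm
      have hw : ∃ w : ∀ j, Fin (n j) → Ω, x = fun j => ⟨n j, w j⟩ := by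
        have hj (j) : ∃ w : Fin (n j) → Ω, x j = ⟨n j, w⟩ := by
          rw [← hlen j]
          exact ⟨(x j).2, rfl⟩
        choose w hw using hj
        exact ⟨w, funext hw⟩
      obtain ⟨w, rfl⟩ := hw
      exact ⟨fun p => q (w p.1 p.2), fun j => funext fun k => h j k, fun j => rfl⟩
    · rintro ⟨y', h1, h2⟩ j k
      rw [← h1 j]
      have h3 := h2 j
      have (z : Points D) (hz : mapPoints q (x j) = z) : counts (q ∘ (x j).2) k = counts z.2 k := by
        subst hz; rfl
      exact this _ h3
  rw [hU, measure_biUnion_finset (fun a _ b _ hab => disjoint_listCell q hab)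
    fun a _ => measurableSet_listCell hq a, Finset.sum_congr rfl (g := fun _ => m (listCell q y)),
    Finset.sum_const, nsmul_eq_mul]
  intro y' hy'
  have h1 := (Finset.mem_filter.1 hy').2
  choose σ hσ using fun j => exists_perm_of_counts_eq (h1 j)
  have hr : Measurable fun (x : J → Points Ω) j =>
      reorder (Function.update (fun _ => Equiv.refl _) (n j) (σ j)) (x j) :=
    measurable_pi_iff.2 fun j => (measurable_reorder _).comp (measurable_pi_apply j)
  -- A group-wise permutation carries `y'` to `y`, so all the cells in the union have the same mass.
  conv_lhs => rw [← hm fun j => Function.update (fun _ => Equiv.refl _) (n j) (σ j)]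
  rw [Measure.map_apply hr (measurableSet_listCell hq y')]
  congr 1
  ext x
  simp only [listCell, Set.mem_preimage, Set.mem_ofPred_eq]
  refine forall_congr' fun j => ?_
  rw [hσ j, mapPoints_reorder_update]

/-- The first points of a list, completed by an arbitrary point. -/
def firstPoints [Nonempty Ω] (n : ℕ) (x : Points Ω) (i : Fin n) : Ω :=
  if h : (i : ℕ) < x.1 then x.2 ⟨i, h⟩ else Classical.arbitrary Ω

theorem measurable_firstPoints [Nonempty Ω] (n : ℕ) (i : Fin n) :
    Measurable fun x : Points Ω => firstPoints n x i := by
  refine measurable_of_sigma fun k => ?_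
  unfold firstPoints
  by_cases h : (i : ℕ) < k
  · simp only [h, dif_pos]
    exact measurable_pi_apply (⟨i, h⟩ : Fin k)
  · simp only [h, dif_neg, not_false_iff]
    exact measurable_const

theorem eq_mk_firstPoints {Ω : Type*} [Nonempty Ω] {n : ℕ} {x : Points Ω} (h : x.1 = n) :
    x = ⟨n, firstPoints n x⟩ := by
  obtain ⟨k, w⟩ := x
  subst h
  rw [Sigma.mk.injEq]
  exact ⟨rfl, heq_of_eq (funext fun i => by simp [firstPoints])⟩

/-- Laws of finite families of lists that are invariant under reordering are determined by the law
of the counting measures. -/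
theorem ext_of_map_counting [Nonempty Ω] {m₁ m₂ : Measure (J → Points Ω)} [IsFiniteMeasure m₁]
    (h₁ : ∀ τ : J → ∀ n : ℕ, Equiv.Perm (Fin n), m₁.map (fun x j => reorder (τ j) (x j)) = m₁)
    (h₂ : ∀ τ : J → ∀ n : ℕ, Equiv.Perm (Fin n), m₂.map (fun x j => reorder (τ j) (x j)) = m₂)
    (hc : m₁.map (fun x j => counting (x j)) = m₂.map (fun x j => counting (x j))) : m₁ = m₂ := by
  classical
  let L : (J → ℕ) → Set (J → Points Ω) := fun n => {x | ∀ j, (x j).1 = n j}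
  have hLU : (⋃ n, L n) = Set.univ :=
    Set.eq_univ_of_forall fun x => Set.mem_iUnion.2 ⟨fun j => (x j).1, fun j => rfl⟩
  have hL (n) : MeasurableSet (L n) := by
    have : L n = (fun (x : J → Points Ω) j => (x j).1) ⁻¹' {n} := by
      ext x; simp [L, funext_iff]
    rw [this]
    exact (measurable_pi_iff.2 fun j => measurable_length.comp (measurable_pi_apply j))
      (measurableSet_singleton n)
  refine (Measure.ext_iff_of_iUnion_eq_univ hLU).2 fun n => ?_
  -- For fixed lengths, which are countably many cases, `R` flattens the lists into one finite
  -- product, where boxes generate; `E` inverts it on `L n`.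
  let R : (J → Points Ω) → ((Σ j, Fin (n j)) → Ω) := fun x p => firstPoints (n p.1) (x p.1) p.2
  have hR : Measurable R := measurable_pi_iff.2 fun p =>
    (measurable_firstPoints (n p.1) p.2).comp (measurable_pi_apply p.1)
  let E : ((Σ j, Fin (n j)) → Ω) → (J → Points Ω) := fun w j => ⟨n j, fun i => w ⟨j, i⟩⟩
  have hE : Measurable E := measurable_pi_iff.2 fun j => (measurable_sigma_mk (n j)).comp
    (measurable_pi_iff.2 fun i => measurable_pi_apply (⟨j, i⟩ : Σ j, Fin (n j)))
  have hER {x} (hx : x ∈ L n) : E (R x) = x := funext fun j => (eq_mk_firstPoints (hx j)).symm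
  have hrec (m : Measure (J → Points Ω)) : m.restrict (L n) = ((m.restrict (L n)).map R).map E := by
    rw [Measure.map_map hE hR]
    conv_lhs => rw [← Measure.map_id (μ := m.restrict (L n))]
    refine Measure.map_congr ?_
    filter_upwards [ae_restrict_mem (hL n)] with x hx
    exact (hER hx).symm
  rw [hrec m₁, hrec m₂]
  congr 1
  have hrect (A : (Σ j, Fin (n j)) → Set Ω) (hA : ∀ p, MeasurableSet (A p)) :
      (m₁.restrict (L n)).map R (Set.univ.pi A) = (m₂.restrict (L n)).map R (Set.univ.pi A) := by
    -- Each point is labelled by all positions `p` whose side `A p` contains it. The box asks that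
    -- the point at `p` carry the label `p`, hence the diagonal condition `y p p`.
    let q : Ω → ((Σ j, Fin (n j)) → Prop) := fun ω p => ω ∈ A p
    have hq : Measurable q := measurable_pi_iff.2 fun p => (hA p).mem
    have hpre : R ⁻¹' Set.univ.pi A ∩ L n =
        ⋃ y ∈ Finset.univ.filter (fun y : (Σ j, Fin (n j)) → (Σ j, Fin (n j)) → Prop =>
          ∀ p, y p p), listCell q y := by
      ext x
      simp only [Set.mem_inter_iff, Set.mem_preimage, Set.mem_pi, Set.mem_univ, true_imp_iff,
        Finset.mem_filter, Finset.mem_univ, true_and, Set.mem_iUnion, exists_prop]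
      constructor
      · rintro ⟨h, hx⟩
        refine ⟨fun p => q (R x p), h, fun j => ?_⟩
        conv_lhs => rw [eq_mk_firstPoints (hx j)]
        rfl
      · rintro ⟨y, hy, hx⟩
        have hxL : x ∈ L n := fun j => congrArg Sigma.fst (hx j)
        refine ⟨fun p => ?_, hxL⟩
        have h1 := hx p.1
        rw [eq_mk_firstPoints (hxL p.1)] at h1
        simp only [mapPoints, Sigma.mk.injEq, heq_eq_eq, true_and] at h1
        have h2 := congrFun (congrFun h1 p.2) p
        exact h2.mpr (hy p)
    have hms : MeasurableSet (Set.univ.pi A) := MeasurableSet.univ_pi hA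
    have hsum (m : Measure (J → Points Ω)) : (m.restrict (L n)).map R (Set.univ.pi A) =
        ∑ y ∈ Finset.univ.filter (fun y : (Σ j, Fin (n j)) → (Σ j, Fin (n j)) → Prop =>
          ∀ p, y p p), m (listCell q y) := by
      rw [Measure.map_apply hR hms, Measure.restrict_apply (hR hms), hpre,
        measure_biUnion_finset (fun a _ b _ hab => disjoint_listCell q hab)
          fun a _ => measurableSet_listCell hq a]
    rw [hsum, hsum]
    refine Finset.sum_congr rfl fun y _ => ?_
    have k₁ := card_mul_measure_listCell hq y h₁
    have k₂ := card_mul_measure_listCell hq y h₂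
    rw [hc, ← k₂] at k₁
    -- The number of labelings can be cancelled: it is finite, and nonzero since `y` itself is
    -- counted.
    refine (ENNReal.mul_right_inj ?_ (ENNReal.natCast_ne_top _)).1 k₁
    rw [Nat.cast_ne_zero]
    exact Finset.card_ne_zero_of_mem (Finset.mem_filter.2 ⟨Finset.mem_univ y, fun j => rfl⟩)
  refine ext_of_generate_finite _ generateFrom_pi.symm isPiSystem_pi ?_ ?_
  · rintro _ ⟨A, hA, rfl⟩
    exact hrect A fun p => hA p (Set.mem_univ p)
  · simpa using hrect (fun _ => Set.univ) fun _ => MeasurableSet.univ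

/-- A version of `ext_of_map_counting` for the joint law of a random variable and a family of
lists. -/
theorem ext_prod_of_map_counting [Nonempty Ω] {V : Type*} [MeasurableSpace V]
    {m₁ m₂ : Measure (V × (J → Points Ω))} [IsFiniteMeasure m₁]
    (h₁ : ∀ τ : J → ∀ n : ℕ, Equiv.Perm (Fin n),
      m₁.map (fun z => (z.1, fun j => reorder (τ j) (z.2 j))) = m₁)
    (h₂ : ∀ τ : J → ∀ n : ℕ, Equiv.Perm (Fin n),
      m₂.map (fun z => (z.1, fun j => reorder (τ j) (z.2 j))) = m₂)
    (hc : m₁.map (fun z => (z.1, fun j => counting (z.2 j))) =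
      m₂.map (fun z => (z.1, fun j => counting (z.2 j)))) : m₁ = m₂ := by
  refine Measure.ext_prod fun {s t} hs ht => ?_
  have hmap {F : Type _} [MeasurableSpace F] (m : Measure (V × (J → Points Ω)))
      {f : (J → Points Ω) → F} (hf : Measurable f) :
      ((m.restrict (s ×ˢ Set.univ)).map Prod.snd).map f =
        ((m.map (fun z => (z.1, f z.2))).restrict (s ×ˢ Set.univ)).map Prod.snd := by
    have hj : Measurable fun z : V × (J → Points Ω) => (z.1, f z.2) :=
      measurable_fst.prodMk (hf.comp measurable_snd)
    rw [Measure.restrict_map hj (hs.prod MeasurableSet.univ), Measure.map_map hf measurable_snd,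
      Measure.map_map measurable_snd hj]
    congr 2
  have hr (τ : J → ∀ n : ℕ, Equiv.Perm (Fin n)) :
      Measurable fun (x : J → Points Ω) j => reorder (τ j) (x j) :=
    measurable_pi_iff.2 fun j => (measurable_reorder (τ j)).comp (measurable_pi_apply j)
  have hcm : Measurable fun (x : J → Points Ω) j => counting (x j) :=
    measurable_pi_iff.2 fun j => measurable_counting.comp (measurable_pi_apply j)
  have key : (m₁.restrict (s ×ˢ Set.univ)).map Prod.snd =
      (m₂.restrict (s ×ˢ Set.univ)).map Prod.snd := by
    refine ext_of_map_counting (fun τ => ?_) (fun τ => ?_) ?_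
    · rw [hmap m₁ (hr τ), h₁ τ]
    · rw [hmap m₂ (hr τ), h₂ τ]
    · rw [hmap m₁ hcm, hmap m₂ hcm, hc]
  have := congrArg (fun ρ => ρ t) key
  simp only [Measure.map_apply measurable_snd ht, Measure.restrict_apply (measurable_snd ht)] at this
  convert this using 2 <;> (ext z; simp [and_comm])

end Exchangeable

/-! ### Rules for conditional distributions and independence. -/

section Conditioning

variable {S A B C E : Type*} [MeasurableSpace S] [MeasurableSpace A] [MeasurableSpace B]
  [MeasurableSpace C] [MeasurableSpace E] {P : Measure S}

theorem hasCondDistrib_congr_kernel {Y : S → B} {Z : S → A} {κ κ' : Kernel A B}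
    [IsSFiniteKernel κ] [IsSFiniteKernel κ'] (h : HasCondDistrib Y Z κ P) (hκ : ∀ᵐ z ∂P.map Z, κ z = κ' z) :
    HasCondDistrib Y Z κ' P := by
  unfold HasCondDistrib at h ⊢
  rwa [← Measure.compProd_congr hκ]

theorem hasCondDistrib_congr_right {Y : S → B} {Z Z' : S → A} {κ : Kernel A B}
    (h : HasCondDistrib Y Z κ P) (hZ : Z' =ᵐ[P] Z) : HasCondDistrib Y Z' κ P := by
  unfold HasCondDistrib at h ⊢
  rw [Measure.map_congr hZ]
  refine h.congr ?_
  filter_upwards [hZ] with s hs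
  rw [hs]

theorem hasCondDistrib_prodMk {X : S → A} {Y : S → B} {Z : S → C} {κ : Kernel A B}
    {η : Kernel (A × B) C} [SFinite P] [IsSFiniteKernel κ] [IsSFiniteKernel η]
    (h₁ : HasCondDistrib Y X κ P) (h₂ : HasCondDistrib Z (fun s => (X s, Y s)) η P) :
    HasCondDistrib (fun s => (Y s, Z s)) X (κ ⊗ₖ η) P := by
  have hX := h₁.aemeasurable_fst
  have hY := h₁.aemeasurable_snd
  have hZ := h₂.aemeasurable_snd
  refine ⟨by fun_prop, ?_⟩
  rw [← Measure.compProd_assoc', ← h₁.map_eq, ← h₂.map_eq,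
    AEMeasurable.map_map_of_aemeasurable (by fun_prop) (by fun_prop)]
  rfl

/-- If `f` and `h` are independent under `μ`, and a further variable is drawn given the value of
`f`, then `f` and the new variable are jointly independent of `h`. -/
theorem map_compProd_comap_eq_prod {μ : Measure E} [IsProbabilityMeasure μ] {f : E → A} {h : E → B}
    (hf : Measurable f) (hh : Measurable h)
    (hind : μ.map (fun x => (f x, h x)) = (μ.map f).prod (μ.map h))
    (β : Kernel A C) [IsMarkovKernel β] :
    (μ ⊗ₘ β.comap f hf).map (fun z => ((f z.1, z.2), h z.1)) =
      ((μ.map f) ⊗ₘ β).prod (μ.map h) := by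
  have : IsProbabilityMeasure (μ.map f) := Measure.isProbabilityMeasure_map hf.aemeasurable
  have : IsProbabilityMeasure (μ.map h) := Measure.isProbabilityMeasure_map hh.aemeasurable
  have hm : Measurable fun z : E × C => ((f z.1, z.2), h z.1) := by fun_prop
  refine Measure.ext_prod₃' fun {s t u} hs ht hu => ?_
  rw [Measure.prod_prod, Measure.compProd_apply_prod hs ht,
    Measure.map_apply hm ((hs.prod ht).prod hu)]
  have hset : (fun z : E × C => ((f z.1, z.2), h z.1)) ⁻¹' ((s ×ˢ t) ×ˢ u) =
      (f ⁻¹' s ∩ h ⁻¹' u) ×ˢ t := by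
    ext z
    simp only [Set.mem_preimage, Set.mem_prod, Set.mem_inter_iff]
    tauto
  have hpre : f ⁻¹' s ∩ h ⁻¹' u = (fun x => (f x, h x)) ⁻¹' (s ×ˢ u) := rfl
  rw [hset, Measure.compProd_apply_prod ((hf hs).inter (hh hu)) ht]
  simp only [Kernel.comap_apply]
  have hb : Measurable fun z : A × B => β z.1 t := (β.measurable_coe ht).comp measurable_fst
  -- The integrand depends on `f` alone, so under the product law of `(f, h)` the integral factors.
  rw [hpre, ← setLIntegral_map (hs.prod hu) hb (hf.prodMk hh), hind, ← Measure.prod_restrict,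
    lintegral_prod _ hb.aemeasurable]
  simp only [lintegral_const, Measure.restrict_apply_univ]
  rw [lintegral_mul_const _ (β.measurable_coe ht)]

theorem indepFun_of_map_eq_prod [IsProbabilityMeasure P] {Y : S → A} {Z : S → B}
    (hY : Measurable Y) (hZ : Measurable Z) {a : Measure A} {b : Measure B}
    [IsProbabilityMeasure a] [IsProbabilityMeasure b]
    (h : P.map (fun s => (Y s, Z s)) = a.prod b) : IndepFun Y Z P := by
  have h1 : P.map Y = a := by
    have := congrArg (fun m => m.map Prod.fst) h
    beta_reduce at this
    rw [Measure.map_map measurable_fst (hY.prodMk hZ), Measure.map_fst_prod, measure_univ,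
      one_smul] at this
    exact this
  have h2 : P.map Z = b := by
    have := congrArg (fun m => m.map Prod.snd) h
    beta_reduce at this
    rw [Measure.map_map measurable_snd (hY.prodMk hZ), Measure.map_snd_prod, measure_univ,
      one_smul] at this
    exact this
  rw [indepFun_iff_map_prod_eq_prod_map_map hY.aemeasurable hZ.aemeasurable, h, h1, h2]

variable {J : Type*} [Fintype J]

/-- For a product of mixtures over integers that can be read off from the outcome, the integers and
the outcomes jointly form a semidirect product. -/
theorem pi_snd_compProd_map_length (β : J → Measure ℕ) [∀ j, IsProbabilityMeasure (β j)]
    (Q : J → Kernel ℕ E) [∀ j, IsMarkovKernel (Q j)] {len : E → ℕ} (hlen : Measurable len)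
    (hQ : ∀ j n, ∀ᵐ y ∂Q j n, len y = n) :
    (Measure.pi fun j => (β j ⊗ₘ Q j).snd).map (fun y => (fun j => len (y j), y)) =
      Measure.pi β ⊗ₘ piKernel fun j => (Q j).comap (fun n => n j) (measurable_pi_apply j) := by
  have h1 : (Measure.pi fun j => (β j ⊗ₘ Q j).snd) =
      (Measure.pi fun j => β j ⊗ₘ Q j).map fun z j => (z j).2 :=
    (Measure.pi_map_pi fun j => measurable_snd.aemeasurable).symm
  rw [← pi_compProd, h1, Measure.map_map (by fun_prop) (by fun_prop)]
  refine Measure.map_congr ?_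
  -- Almost surely the integer equals the length read off from the outcome, so retaining it or
  -- recomputing it gives the same joint law.
  have h2 (j) : ∀ᵐ z ∂β j ⊗ₘ Q j, len z.2 = z.1 :=
    Measure.ae_compProd_of_ae_ae
      (measurableSet_eq_fun (hlen.comp measurable_snd) measurable_fst)
      (Filter.Eventually.of_forall fun n => hQ j n)
  have h3 : ∀ᵐ z ∂Measure.pi fun j => β j ⊗ₘ Q j, ∀ j, len (z j).2 = (z j).1 :=
    ae_all_iff.2 fun j =>
      (Measure.tendsto_eval_ae_ae (μ := fun j => β j ⊗ₘ Q j) (i := j)).eventually (h2 j)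
  filter_upwards [h3] with z hz
  simp [hz]

end Conditioning

/-! ### Conditioning Poisson points on their numbers. -/

section PoissonPoints

variable {Ω : Type*} [MeasurableSpace Ω]

/-- The integer part of the total mass of a measure. -/
def totalCount (μ : Measure Ω) : ℕ := ⌊μ.real Set.univ⌋₊

theorem measurable_totalCount : Measurable (totalCount : Measure Ω → ℕ) :=
  Nat.measurable_floor.comp (measurable_real_apply MeasurableSet.univ)

theorem totalCount_counting (x : Points Ω) : totalCount (counting x) = x.1 := by
  simp [totalCount, Measure.real, counting_univ]

variable [Nonempty Ω]

/-- The Poisson distributions, as a kernel from the parameter. -/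
def poissonKernel : Kernel ℝ ℕ where
  toFun t := poissonMeasure t.toNNReal
  measurable' := by
    refine Measure.measurable_of_measurable_coe _ fun s _ => ?_
    have h (t : ℝ) : poissonMeasure t.toNNReal s =
        ∑' n : ℕ, ENNReal.ofReal (Real.exp (-(t.toNNReal : ℝ)) * (t.toNNReal : ℝ) ^ n /
          n.factorial) * Measure.dirac n s := by
      rw [poissonMeasure, Measure.sum_apply _ (Set.to_countable s).measurableSet]
      rfl
    simp_rw [h]
    fun_prop

theorem poissonKernel_apply (t : ℝ) : poissonKernel t = poissonMeasure t.toNNReal := rfl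

instance : IsMarkovKernel poissonKernel := ⟨fun t => by
  rw [poissonKernel_apply]
  infer_instance⟩

/-- The points of a Poisson process, as a kernel from the mean measure. -/
def poissonPointsKernel (Ω : Type*) [MeasurableSpace Ω] [Nonempty Ω] :
    Kernel (Measure Ω) (Points Ω) :=
  ((poissonKernel.comap (fun μ : Measure Ω => μ.real Set.univ)
    (measurable_real_apply MeasurableSet.univ)) ⊗ₖ
    ((iidKernel Ω).comap (fun z : Measure Ω × ℕ => (z.2, normalize z.1))
      (measurable_snd.prodMk (measurable_normalize.comp measurable_fst)))).snd

theorem poissonPointsKernel_apply (μ : Measure Ω) :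
    poissonPointsKernel Ω μ = (poissonPoints μ).snd := by
  rw [poissonPointsKernel, Kernel.snd_apply, Kernel.compProd_apply_eq_compProd_sectR]
  rfl

instance : IsMarkovKernel (poissonPointsKernel Ω) := by
  unfold poissonPointsKernel
  infer_instance

theorem poissonPoints_snd_map_reorder (μ : Measure Ω) (τ : ∀ n : ℕ, Equiv.Perm (Fin n)) :
    (poissonPoints μ).snd.map (reorder τ) = (poissonPoints μ).snd := by
  ext s hs
  rw [Measure.map_apply (measurable_reorder τ) hs,
    poissonPoints_map_snd_apply _ (measurable_reorder τ hs), poissonPoints_map_snd_apply _ hs]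
  refine tsum_congr fun n => ?_
  rw [← Measure.map_apply (measurable_reorder τ) hs, iidPoints_map_reorder]

variable {S J E V : Type*} [MeasurableSpace S] [Fintype J] [MeasurableSpace E] [MeasurableSpace V]

/-- The kernel that draws independent families of independent points, `z.1.1 j` of them from
`z.2 j`, and applies `F` to each family. -/
def iidFamilyKernel {Z : Type*} [MeasurableSpace Z] (num : Z → J → ℕ) (hnum : Measurable num)
    (ν : Z → J → Measure Ω) (hν : Measurable ν) {F : Points Ω → E} (hF : Measurable F) :
    Kernel Z (J → E) :=
  have (j : J) : IsMarkovKernel (((iidKernel Ω).map F).comap (fun z => (num z j, ν z j))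
      (((measurable_pi_apply j).comp hnum).prodMk ((measurable_pi_apply j).comp hν))) :=
    have := Kernel.IsMarkovKernel.map (iidKernel Ω) hF
    inferInstance
  piKernel fun j => ((iidKernel Ω).map F).comap (fun z => (num z j, ν z j))
    (((measurable_pi_apply j).comp hnum).prodMk ((measurable_pi_apply j).comp hν))

theorem iidFamilyKernel_apply {Z : Type*} [MeasurableSpace Z] {num : Z → J → ℕ}
    (hnum : Measurable num) {ν : Z → J → Measure Ω} (hν : Measurable ν) {F : Points Ω → E}
    (hF : Measurable F) (z : Z) : iidFamilyKernel num hnum ν hν hF z =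
      Measure.pi fun j => (iidKernel Ω (num z j, ν z j)).map F := by
  rw [iidFamilyKernel, piKernel_apply]
  simp only [Kernel.comap_apply, Kernel.map_apply _ hF]

instance {Z : Type*} [MeasurableSpace Z] (num : Z → J → ℕ) (hnum : Measurable num)
    (ν : Z → J → Measure Ω) (hν : Measurable ν) {F : Points Ω → E} (hF : Measurable F) :
    IsMarkovKernel (iidFamilyKernel num hnum ν hν hF) := by
  unfold iidFamilyKernel
  infer_instance

/-- Given the mean measures and the numbers of points, the points of independent Poisson processes
are independent and drawn from the normalized mean measures. -/
theorem hasCondDistrib_iidFamily {P : Measure S} [IsProbabilityMeasure P] {W : S → V}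
    {mean : V → J → Measure Ω} (hmean : Measurable mean) {Y : S → J → E} {κ : Kernel V (J → E)}
    [IsMarkovKernel κ] (h : HasCondDistrib Y W κ P) {F : Points Ω → E} (hF : Measurable F)
    (hκ : ∀ᵐ w ∂P.map W, κ w = Measure.pi fun j => (poissonPoints (mean w j)).snd.map F)
    {len : E → ℕ} (hlen : Measurable len) (hlenF : ∀ x, len (F x) = x.1) :
    HasCondDistrib Y (fun s => (W s, fun j => len (Y s j)))
      (iidFamilyKernel Prod.snd measurable_snd (fun z j => normalize (mean z.1 j))
        (measurable_pi_iff.2 fun j => measurable_normalize.comp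
          ((measurable_pi_apply j).comp (hmean.comp measurable_fst))) hF) P := by
  -- The lengths are adjoined to the outcome; once the pair is written as Poisson numbers followed
  -- by independent draws, `HasCondDistrib.of_compProd` moves the numbers to the conditioning side.
  -- The map `F` covers both lists and counting measures.
  have hpair : Measurable fun y : J → E => (fun j => len (y j), y) := by fun_prop
  have h1 := h.comp_left hpair
  have hmj (j : J) : Measurable fun w => (mean w j).real Set.univ :=
    (measurable_real_apply MeasurableSet.univ).comp ((measurable_pi_apply j).comp hmean)
  have hFk := Kernel.IsMarkovKernel.map (iidKernel Ω) hF
  refine HasCondDistrib.of_compProd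
    (κ := piKernel fun j => poissonKernel.comap (fun w => (mean w j).real Set.univ) (hmj j))
    (hasCondDistrib_congr_kernel h1 ?_)
  filter_upwards [hκ] with w hw
  rw [Kernel.map_apply _ hpair, hw, Kernel.compProd_apply_eq_compProd_sectR]
  have h2 (j : J) : (poissonPoints (mean w j)).snd.map F =
      (poissonMeasure ((mean w j).real Set.univ).toNNReal ⊗ₘ
        (((iidKernel Ω).map F).comap (fun n => (n, normalize (mean w j)))
          measurable_prodMk_right)).snd := by
    rw [poissonPoints, Measure.snd, Measure.snd, Measure.map_map hF measurable_snd]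
    have h3 : ((iidKernel Ω).map F).comap (fun n => (n, normalize (mean w j)))
        measurable_prodMk_right = ((iidKernel Ω).comap (fun n => (n, normalize (mean w j)))
          measurable_prodMk_right).map F := by
      ext n : 1
      rw [Kernel.comap_apply, Kernel.map_apply _ hF, Kernel.map_apply _ hF, Kernel.comap_apply]
    rw [h3, Measure.compProd_map hF, Measure.map_map measurable_snd (by fun_prop)]
    rfl
  simp_rw [h2]
  rw [pi_snd_compProd_map_length _ _ hlen]
  · rfl
  · intro j n
    rw [Kernel.comap_apply, Kernel.map_apply _ hF]
    refine (ae_map_iff hF.aemeasurable (measurableSet_eq_fun hlen measurable_const)).2 ?_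
    simp only [hlenF]
    exact ae_length_iidPoints n _

end PoissonPoints

/-! ### Totals and normalizations in the hierarchy. -/

section Model

variable {Ω : Type*} [MeasurableSpace Ω]

/-- The total mass is positive and finite. -/
def HasProperMass (μ : Measure Ω) : Prop := μ Set.univ ≠ 0 ∧ μ Set.univ ≠ ⊤

theorem measurableSet_hasProperMass : MeasurableSet {μ : Measure Ω | HasProperMass μ} := by
  have h : Measurable fun μ : Measure Ω => μ Set.univ := Measure.measurable_coe MeasurableSet.univ
  exact (h (measurableSet_singleton 0)).compl.inter (h (measurableSet_singleton ⊤)).compl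

theorem IsGammaProcessLaw.ae_hasProperMass {c : ℝ} {H : Measure Ω} {ρ : Measure (Measure Ω)}
    (h : IsGammaProcessLaw c H ρ) (hc : 0 < c) (hH : HasProperMass H) :
    ∀ᵐ μ ∂ρ, HasProperMass μ := by
  have : IsFiniteMeasure H := ⟨lt_top_iff_ne_top.2 hH.2⟩
  filter_upwards [h.finite, h.ae_pos hc (by simpa using hH.1)] with μ h1 h2
  exact ⟨h2, measure_ne_top μ _⟩

theorem HasProperMass.eq_map_counting [Nonempty Ω] {H : Measure Ω} (hH : HasProperMass H)
    {ρ : Measure (Measure Ω)} (h : IsPoissonProcessLaw H ρ) :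
    ρ = (poissonPoints H).snd.map counting := by
  have : IsFiniteMeasure H := ⟨lt_top_iff_ne_top.2 hH.2⟩
  exact h.eq_map_counting (by simpa using hH.1)

theorem IsPoissonProcessLaw.map_totalCount {H : Measure Ω} {ρ : Measure (Measure Ω)}
    (h : IsPoissonProcessLaw H ρ) :
    ρ.map totalCount = poissonMeasure (H.real Set.univ).toNNReal := by
  have h1 := congrArg (fun m => m.map fun x : ℝ => ⌊x⌋₊) (h.map_real_apply MeasurableSet.univ)
  beta_reduce at h1
  rw [Measure.map_map Nat.measurable_floor (measurable_real_apply MeasurableSet.univ),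
    Measure.map_map Nat.measurable_floor (measurable_of_countable _)] at h1
  refine Eq.trans h1 ?_
  have : (fun x : ℝ => ⌊x⌋₊) ∘ (fun n : ℕ => (n : ℝ)) = id := by ext n; simp
  rw [this, Measure.map_id]

variable {J : Type*}

/-- The total masses of a family of measures. -/
def totals (μ : J → Measure Ω) (j : J) : ℝ := (μ j).real Set.univ

theorem measurable_totals : Measurable (totals : (J → Measure Ω) → J → ℝ) :=
  measurable_pi_iff.2 fun j =>
    (measurable_real_apply MeasurableSet.univ).comp (measurable_pi_apply j)

theorem measurable_totals_snd :
    Measurable fun w : Measure Ω × (J → Measure Ω) => totals w.2 :=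
  measurable_totals.comp measurable_snd

/-- The normalizations of a family of measures. -/
def normalizeAll (μ : J → Measure Ω) (j : J) : Measure Ω := normalize (μ j)

theorem measurable_normalizeAll :
    Measurable (normalizeAll : (J → Measure Ω) → J → Measure Ω) :=
  measurable_pi_iff.2 fun j => measurable_normalize.comp (measurable_pi_apply j)

variable [Fintype J]

/-- The right-hand side involves `g` only through its total mass, which is why the totals carry no
information on the normalization of `G` beyond `α`. -/
theorem pi_map_totals {c : J → ℝ} (hc : ∀ j, 0 < c j) {g : Measure Ω} (hg : HasProperMass g)
    {r : J → Measure (Measure Ω)} (hr : ∀ j, IsGammaProcessLaw (c j) g (r j)) :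
    (Measure.pi r).map totals = Measure.pi fun j => gammaMeasure (g.real Set.univ) (c j) := by
  have : IsFiniteMeasure g := ⟨lt_top_iff_ne_top.2 hg.2⟩
  have hg0 : g ≠ 0 := by simpa using hg.1
  have hu : Measurable fun μ : Measure Ω => μ.real Set.univ :=
    measurable_real_apply MeasurableSet.univ
  have hprob (j) := (hr j).prob
  have (j : J) : IsProbabilityMeasure ((r j).map fun μ => μ.real Set.univ) :=
    Measure.isProbabilityMeasure_map hu.aemeasurable
  refine (Measure.pi_map_pi fun j => hu.aemeasurable).trans ?_
  simp_rw [fun j => (hr j).map_real_univ (hc j) hg0]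

theorem pi_map_normalizeAll {r : J → Measure (Measure Ω)} [∀ j, IsProbabilityMeasure (r j)] :
    (Measure.pi r).map normalizeAll = Measure.pi fun j => (r j).map normalize :=
  have (j : J) : IsProbabilityMeasure ((r j).map normalize) :=
    Measure.isProbabilityMeasure_map measurable_normalize.aemeasurable
  Measure.pi_map_pi fun _ => measurable_normalize.aemeasurable

/-- The total masses and the normalizations of independent gamma processes are independent. -/
theorem pi_map_totals_normalizeAll {c : J → ℝ} (hc : ∀ j, 0 < c j) {g : Measure Ω}
    (hg : HasProperMass g) {r : J → Measure (Measure Ω)}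
    (hr : ∀ j, IsGammaProcessLaw (c j) g (r j)) :
    (Measure.pi r).map (fun μ => (totals μ, normalizeAll μ)) =
      ((Measure.pi r).map totals).prod ((Measure.pi r).map normalizeAll) := by
  have : IsFiniteMeasure g := ⟨lt_top_iff_ne_top.2 hg.2⟩
  have hg0 : g ≠ 0 := by simpa using hg.1
  have hu : Measurable fun μ : Measure Ω => μ.real Set.univ :=
    measurable_real_apply MeasurableSet.univ
  have hj : Measurable fun μ : Measure Ω => (μ.real Set.univ, normalize μ) :=
    hu.prodMk measurable_normalize
  have hprob (j) := (hr j).prob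
  have (j : J) : IsProbabilityMeasure ((r j).map fun μ => μ.real Set.univ) :=
    Measure.isProbabilityMeasure_map hu.aemeasurable
  have (j : J) : IsProbabilityMeasure ((r j).map normalize) :=
    Measure.isProbabilityMeasure_map measurable_normalize.aemeasurable
  have (j : J) : IsProbabilityMeasure ((r j).map fun μ => (μ.real Set.univ, normalize μ)) :=
    Measure.isProbabilityMeasure_map hj.aemeasurable
  have h1 : (Measure.pi r).map (fun μ j => ((μ j).real Set.univ, normalize (μ j))) =
      Measure.pi fun j => ((r j).map fun μ => μ.real Set.univ).prod ((r j).map normalize) := by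
    refine (Measure.pi_map_pi fun j => hj.aemeasurable).trans ?_
    simp_rw [fun j => (hr j).map_total_normalize (hc j) hg0]
  have h2 := (measurePreserving_arrowProdEquivProdArrow ℝ (Measure Ω) J
    (fun j => (r j).map fun μ => μ.real Set.univ) fun j => (r j).map normalize).map_eq
  have h3 : (Measure.pi r).map totals = Measure.pi fun j => (r j).map fun μ => μ.real Set.univ :=
    Measure.pi_map_pi fun j => hu.aemeasurable
  rw [h3, pi_map_normalizeAll, ← h2, ← h1, Measure.map_map (MeasurableEquiv.measurable _)
    (by exact measurable_pi_iff.2 fun j => hj.comp (measurable_pi_apply j))]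
  rfl

/-- Independent Poisson variables, as a kernel from their parameters. -/
def poissonFamilyKernel (J : Type*) [Fintype J] : Kernel (J → ℝ) (J → ℕ) :=
  piKernel fun j => poissonKernel.comap (fun t => t j) (measurable_pi_apply j)

instance : IsMarkovKernel (poissonFamilyKernel J) := by
  unfold poissonFamilyKernel
  infer_instance

variable {S : Type*} [MeasurableSpace S] {P : Measure S}
  {G : S → Measure Ω} {Λ X : J → S → Measure Ω} {κΛ : Kernel (Measure Ω) (J → Measure Ω)}
  {κX : Kernel (Measure Ω × (J → Measure Ω)) (J → Measure Ω)}

theorem ae_hasProperMass_Λ {c : J → ℝ} (hc : ∀ j, 0 < c j)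
    (hG : ∀ᵐ g ∂P.map G, HasProperMass g)
    (hΛ : HasCondDistrib (fun s j => Λ j s) G κΛ P)
    (hΛlaw : ∀ᵐ g ∂P.map G, IsProductLaw (fun j => IsGammaProcessLaw (c j) g) (κΛ g)) :
    ∀ᵐ w ∂P.map (fun s => (G s, fun j => Λ j s)), ∀ j, HasProperMass (w.2 j) := by
  rw [hΛ.map_eq]
  have hset (j : J) : MeasurableSet {w : Measure Ω × (J → Measure Ω) | HasProperMass (w.2 j)} :=
    measurableSet_preimage (f := fun w : Measure Ω × (J → Measure Ω) => w.2 j) (by fun_prop)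
      measurableSet_hasProperMass
  refine ae_all_iff.2 fun j => Measure.ae_compProd_of_ae_ae (hset j) ?_
  filter_upwards [hG, hΛlaw] with g hg hl
  obtain ⟨r, hr, hκ⟩ := hl
  have hprob (j) := (hr j).prob
  rw [hκ]
  exact (Measure.tendsto_eval_ae_ae (μ := r) (i := j)).eventually
    ((hr j).ae_hasProperMass (hc j) hg)

/-- Almost surely all `Λ_j` have positive finite mass, so the abstract Poisson process laws may be
replaced by explicit points. -/
theorem ae_eq_pi_map_counting [Nonempty Ω]
    (hprop : ∀ᵐ w ∂P.map (fun s => (G s, fun j => Λ j s)), ∀ j, HasProperMass (w.2 j))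
    (hXlaw : ∀ᵐ w ∂P.map (fun s => (G s, fun j => Λ j s)),
      IsProductLaw (fun j => IsPoissonProcessLaw (w.2 j)) (κX w)) :
    ∀ᵐ w ∂P.map (fun s => (G s, fun j => Λ j s)),
      κX w = Measure.pi fun j => (poissonPoints (w.2 j)).snd.map counting := by
  filter_upwards [hprop, hXlaw] with w hw hl
  obtain ⟨r, hr, hκ⟩ := hl
  rw [hκ]
  congr 1
  exact funext fun j => (hw j).eq_map_counting (hr j)

/-- The total counts are almost surely natural numbers. -/
theorem ae_eq_totalCount [Nonempty Ω]
    (hX : HasCondDistrib (fun s j => X j s) (fun s => (G s, fun j => Λ j s)) κX P)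
    (hκ : ∀ᵐ w ∂P.map (fun s => (G s, fun j => Λ j s)),
      κX w = Measure.pi fun j => (poissonPoints (w.2 j)).snd.map counting) (j : J) :
    ∀ᵐ s ∂P, X j s Set.univ = (totalCount (X j s) : ENNReal) := by
  have hset : MeasurableSet {μ : Measure Ω | μ Set.univ = (totalCount μ : ENNReal)} :=
    measurableSet_eq_fun (Measure.measurable_coe MeasurableSet.univ)
      ((measurable_of_countable _).comp measurable_totalCount)
  have h1 : ∀ᵐ z ∂P.map (fun s => ((G s, fun j => Λ j s), fun j => X j s)),
      z.2 j Set.univ = (totalCount (z.2 j) : ENNReal) := by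
    rw [hX.map_eq]
    refine Measure.ae_compProd_of_ae_ae (measurableSet_eq_fun ?_ ?_) ?_
    · exact (Measure.measurable_coe MeasurableSet.univ).comp
        ((measurable_pi_apply j).comp measurable_snd)
    · exact (measurable_of_countable _).comp (measurable_totalCount.comp
        ((measurable_pi_apply j).comp measurable_snd))
    filter_upwards [hκ] with w hw
    have (j : J) : IsProbabilityMeasure ((poissonPoints (w.2 j)).snd.map counting) :=
      Measure.isProbabilityMeasure_map measurable_counting.aemeasurable
    rw [hw]
    refine (Measure.tendsto_eval_ae_ae (i := j)
      (μ := fun j => (poissonPoints (w.2 j)).snd.map counting)).eventually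
      ((ae_map_iff measurable_counting.aemeasurable hset).2 (Filter.Eventually.of_forall fun x => ?_))
    rw [totalCount_counting, counting_univ]
  exact ae_of_ae_map hX.aemeasurable h1

variable [IsProbabilityMeasure P] [IsMarkovKernel κΛ] [IsMarkovKernel κX]

/-- The kernel factors through the totals of the `Λ_j`; hence adding the counts to these totals
preserves their independence from the normalizations. -/
theorem hasCondDistrib_totalCount
    (hX : HasCondDistrib (fun s j => X j s) (fun s => (G s, fun j => Λ j s)) κX P)
    (hXlaw : ∀ᵐ w ∂P.map (fun s => (G s, fun j => Λ j s)),
      IsProductLaw (fun j => IsPoissonProcessLaw (w.2 j)) (κX w)) :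
    HasCondDistrib (fun s j => totalCount (X j s)) (fun s => (G s, fun j => Λ j s))
      ((poissonFamilyKernel J).comap (fun w : Measure Ω × (J → Measure Ω) => totals w.2)
        measurable_totals_snd) P := by
  have hm : Measurable fun (x : J → Measure Ω) j => totalCount (x j) :=
    measurable_pi_iff.2 fun j => measurable_totalCount.comp (measurable_pi_apply j)
  refine hasCondDistrib_congr_kernel (hX.comp_left hm) ?_
  filter_upwards [hXlaw] with w hl
  obtain ⟨r, hr, hκ⟩ := hl
  have hprob (j) := (hr j).prob
  have (j : J) : IsProbabilityMeasure ((r j).map totalCount) :=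
    Measure.isProbabilityMeasure_map measurable_totalCount.aemeasurable
  rw [Kernel.map_apply _ hm, hκ, Kernel.comap_apply, poissonFamilyKernel, piKernel_apply]
  refine (Measure.pi_map_pi fun j => measurable_totalCount.aemeasurable).trans ?_
  simp_rw [fun j => (hr j).map_totalCount]
  rfl

/-- The joint law of the totals `(T_j)_j`, `(N_j)_j` given `G`. -/
def totalsKernel (κΛ : Kernel (Measure Ω) (J → Measure Ω)) :
    Kernel (Measure Ω) ((J → ℝ) × (J → ℕ)) :=
  (κΛ.map totals) ⊗ₖ ((poissonFamilyKernel J).comap Prod.snd measurable_snd)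

instance : IsMarkovKernel (κΛ.map (totals : (J → Measure Ω) → _)) :=
  Kernel.IsMarkovKernel.map _ measurable_totals

instance : IsMarkovKernel (κΛ.map (normalizeAll : (J → Measure Ω) → _)) :=
  Kernel.IsMarkovKernel.map _ measurable_normalizeAll

instance : IsMarkovKernel (totalsKernel κΛ) := by
  unfold totalsKernel
  infer_instance

theorem totalsKernel_apply (g : Measure Ω) :
    totalsKernel κΛ g = (κΛ g).map totals ⊗ₘ poissonFamilyKernel J := by
  rw [totalsKernel, Kernel.compProd_apply_eq_compProd_sectR, Kernel.map_apply _ measurable_totals]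
  rfl

/-- Given `G`, the totals are independent of the normalizations of the `Λ_j`. -/
theorem hasCondDistrib_totals_normalizeAll {c : J → ℝ} (hc : ∀ j, 0 < c j)
    (hG : ∀ᵐ g ∂P.map G, HasProperMass g)
    (hΛ : HasCondDistrib (fun s j => Λ j s) G κΛ P)
    (hΛlaw : ∀ᵐ g ∂P.map G, IsProductLaw (fun j => IsGammaProcessLaw (c j) g) (κΛ g))
    (hX : HasCondDistrib (fun s j => X j s) (fun s => (G s, fun j => Λ j s)) κX P)
    (hXlaw : ∀ᵐ w ∂P.map (fun s => (G s, fun j => Λ j s)),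
      IsProductLaw (fun j => IsPoissonProcessLaw (w.2 j)) (κX w)) :
    HasCondDistrib (fun s => ((totals (fun j => Λ j s), fun j => totalCount (X j s)),
        normalizeAll fun j => Λ j s)) G
      (totalsKernel κΛ ⊗ₖ (κΛ.map normalizeAll).comap Prod.fst measurable_fst) P := by
  have hf : Measurable fun z : (J → Measure Ω) × (J → ℕ) =>
      ((totals z.1, z.2), normalizeAll z.1) :=
    ((measurable_totals.comp measurable_fst).prodMk measurable_snd).prodMk
      (measurable_normalizeAll.comp measurable_fst)
  refine hasCondDistrib_congr_kernel
    ((hasCondDistrib_prodMk hΛ (hasCondDistrib_totalCount hX hXlaw)).comp_left hf) ?_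
  filter_upwards [hG, hΛlaw] with g hg hl
  obtain ⟨r, hr, hκ⟩ := hl
  have h1 : (κΛ g).map (fun μ => (totals μ, normalizeAll μ)) =
      ((κΛ g).map totals).prod ((κΛ g).map normalizeAll) := by
    rw [hκ, pi_map_totals_normalizeAll hc hg hr]
  -- The counts are drawn from the `T_j` alone, so the independence in `h1` extends from `(T_j)` to
  -- `(T_j, N_j)`.
  have h2 := map_compProd_comap_eq_prod measurable_totals measurable_normalizeAll h1
    (poissonFamilyKernel J)
  rw [Kernel.map_apply _ hf, Kernel.compProd_apply_eq_compProd_sectR,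
    Kernel.compProd_apply_eq_compProd_sectR, totalsKernel_apply]
  refine Eq.trans h2 ?_
  rw [← Measure.compProd_const, ← Kernel.map_apply κΛ measurable_normalizeAll]
  rfl

end Model

/-! ### The conditional laws given totals and normalized measures. -/

section Normalized

variable {Ω : Type*} [MeasurableSpace Ω]

theorem real_univ_ofReal_smul {a : ℝ} (ha : 0 < a) (ν : Measure Ω) [IsProbabilityMeasure ν] :
    (ENNReal.ofReal a • ν).real Set.univ = a := by
  simp [Measure.real, ha.le]

theorem normalize_ofReal_smul {a : ℝ} (ha : 0 < a) (ν : Measure Ω) [IsProbabilityMeasure ν] :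
    normalize (ENNReal.ofReal a • ν) = ν := by
  rw [normalize, smul_smul]
  simp [ENNReal.inv_mul_cancel, ha]

theorem HasProperMass.ofReal_smul_normalize {μ : Measure Ω} (h : HasProperMass μ) :
    ENNReal.ofReal (μ.real Set.univ) • normalize μ = μ :=
  GammaNB.ofReal_smul_normalize h.1 h.2

theorem HasProperMass.isProbabilityMeasure_normalize {μ : Measure Ω} (h : HasProperMass μ) :
    IsProbabilityMeasure (normalize μ) :=
  GammaNB.isProbabilityMeasure_normalize h.1 h.2

theorem HasProperMass.real_pos {μ : Measure Ω} (h : HasProperMass μ) : 0 < μ.real Set.univ :=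
  ENNReal.toReal_pos h.1 h.2

variable {J : Type*} [Fintype J] {S : Type*} [MeasurableSpace S] {P : Measure S}
  [IsProbabilityMeasure P] {G : S → Measure Ω} {Λ X : J → S → Measure Ω}
  {κΛ : Kernel (Measure Ω) (J → Measure Ω)} [IsMarkovKernel κΛ]

/-- Given `G` through its total mass and its normalization, and given the totals of the `Λ_j` and
`X_j`, the normalizations of the `Λ_j` are independent Dirichlet processes. -/
theorem hasCondLaw_normalizeAll {c : J → ℝ} (hc : ∀ j, 0 < c j) (hGm : Measurable G)
    {TN : S → (J → ℝ) × (J → ℕ)} (hTN : Measurable TN)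
    (hG : ∀ᵐ g ∂P.map G, HasProperMass g)
    (hΛlaw : ∀ᵐ g ∂P.map G, IsProductLaw (fun j => IsGammaProcessLaw (c j) g) (κΛ g))
    (h : HasCondDistrib (fun s => (TN s, normalizeAll fun j => Λ j s)) G
      (totalsKernel κΛ ⊗ₖ (κΛ.map normalizeAll).comap Prod.fst measurable_fst) P) :
    HasCondLaw P (fun s => normalizeAll fun j => Λ j s)
      (fun s => (((G s).real Set.univ, TN s), normalize (G s)))
      (fun z => IsProductLaw fun _ => IsDirichletProcessLaw z.1.1 z.2) := by
  -- Multiplying total by normalization recovers `G` when its mass is positive and finite, so a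
  -- kernel given `G` becomes a kernel given `(α, G̃)`.
  have hθ : Measurable fun z : (ℝ × (J → ℝ) × (J → ℕ)) × Measure Ω =>
      ENNReal.ofReal z.1.1 • z.2 :=
    measurable_smul_measure.comp (by fun_prop : Measurable
      fun z : (ℝ × (J → ℝ) × (J → ℕ)) × Measure Ω => (z.1.1, z.2))
  have hψ : Measurable fun z : Measure Ω × ((J → ℝ) × (J → ℕ)) =>
      ((z.1.real Set.univ, z.2), normalize z.1) :=
    (((measurable_real_apply MeasurableSet.univ).comp measurable_fst).prodMk
      measurable_snd).prodMk (measurable_normalize.comp measurable_fst)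
  have hZ : Measurable fun s => (((G s).real Set.univ, TN s), normalize (G s)) :=
    hψ.comp (hGm.prodMk hTN)
  have hGs : ∀ᵐ s ∂P, HasProperMass (G s) := ae_of_ae_map hGm.aemeasurable hG
  refine ⟨(κΛ.map normalizeAll).comap _ hθ, inferInstance, ?_, ?_⟩
  -- In `h` the second kernel ignores the totals, so they can join the conditioning variables; `ψ`
  -- then replaces `G` by its mass and normalization.
  · refine HasCondDistrib.comp_right (hf := hψ) (Z := fun s => (G s, TN s))
      (hasCondDistrib_congr_kernel h.of_compProd ?_)
    have hset : MeasurableSet {z : Measure Ω × ((J → ℝ) × (J → ℕ)) | HasProperMass z.1} :=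
      measurableSet_preimage (f := Prod.fst) measurable_fst measurableSet_hasProperMass
    filter_upwards [(ae_map_iff (hGm.prodMk hTN).aemeasurable hset).2 hGs] with z hz
    simp only [Kernel.comap_apply, hz.ofReal_smul_normalize]
  · have hmap : (P.map fun s => (((G s).real Set.univ, TN s), normalize (G s))).map
        (fun z => ENNReal.ofReal z.1.1 • z.2) = P.map G := by
      rw [Measure.map_map hθ hZ]
      refine Measure.map_congr ?_
      filter_upwards [hGs] with s hs
      exact hs.ofReal_smul_normalize
    have hset : MeasurableSet {z : (ℝ × (J → ℝ) × (J → ℕ)) × Measure Ω |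
        0 < z.1.1 ∧ IsProbabilityMeasure z.2} := by
      have h₁ : MeasurableSet {z : (ℝ × (J → ℝ) × (J → ℕ)) × Measure Ω | 0 < z.1.1} :=
        measurableSet_lt measurable_const (by fun_prop)
      exact h₁.inter
        (measurableSet_preimage (f := Prod.snd) measurable_snd measurableSet_isProbabilityMeasure)
    have hae : ∀ᵐ z ∂P.map fun s => (((G s).real Set.univ, TN s), normalize (G s)),
        0 < z.1.1 ∧ IsProbabilityMeasure z.2 := by
      refine (ae_map_iff hZ.aemeasurable hset).2 ?_
      filter_upwards [hGs] with s hs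
      exact ⟨hs.real_pos, hs.isProbabilityMeasure_normalize⟩
    rw [← hmap] at hΛlaw hG
    filter_upwards [hae, ae_of_ae_map hθ.aemeasurable hΛlaw, ae_of_ae_map hθ.aemeasurable hG]
      with z hz hl hg
    obtain ⟨r, hr, hκ⟩ := hl
    have := hz.2
    have hprob (j) := (hr j).prob
    have : IsFiniteMeasure (ENNReal.ofReal z.1.1 • z.2) := ⟨lt_top_iff_ne_top.2 hg.2⟩
    refine ⟨fun j => (r j).map normalize, fun j => ?_, ?_⟩
    · have h1 := (hr j).isDirichletProcessLaw_normalize (hc j)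
        (fun h0 => hg.1 (by rw [h0]; simp))
      rwa [real_univ_ofReal_smul hz.1, normalize_ofReal_smul hz.1] at h1
    · rw [Kernel.comap_apply, Kernel.map_apply _ measurable_normalizeAll, hκ, pi_map_normalizeAll]

/-- The normalization of `G` is independent of the totals of `G`, of the `Λ_j` and of the `X_j`. -/
theorem indepFun_normalize_totals {c₀ : ℝ} (hc₀ : 0 < c₀) {G₀ : Measure Ω} [IsFiniteMeasure G₀]
    (hG₀ : G₀ ≠ 0) (hlaw : IsGammaProcessLaw c₀ G₀ (P.map G)) {c : J → ℝ} (hc : ∀ j, 0 < c j)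
    (hGm : Measurable G) {TN : S → (J → ℝ) × (J → ℕ)} (hTN : Measurable TN)
    (hG : ∀ᵐ g ∂P.map G, HasProperMass g)
    (hΛlaw : ∀ᵐ g ∂P.map G, IsProductLaw (fun j => IsGammaProcessLaw (c j) g) (κΛ g))
    (h : HasCondDistrib TN G (totalsKernel κΛ) P) :
    IndepFun (fun s => normalize (G s)) (fun s => ((G s).real Set.univ, TN s)) P := by
  have hu : Measurable fun μ : Measure Ω => μ.real Set.univ :=
    measurable_real_apply MeasurableSet.univ
  have hj : Measurable fun μ : Measure Ω => (μ.real Set.univ, normalize μ) :=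
    hu.prodMk measurable_normalize
  have : IsProbabilityMeasure (P.map G) := Measure.isProbabilityMeasure_map hGm.aemeasurable
  have hA : IsProbabilityMeasure ((P.map G).map fun μ => μ.real Set.univ) :=
    Measure.isProbabilityMeasure_map hu.aemeasurable
  have hD : IsProbabilityMeasure ((P.map G).map normalize) :=
    Measure.isProbabilityMeasure_map measurable_normalize.aemeasurable
  have hprod := hlaw.map_total_normalize hc₀ hG₀
  let law : ℝ → Measure ((J → ℝ) × (J → ℕ)) := fun a =>
    (Measure.pi fun j => gammaMeasure a (c j)) ⊗ₘ poissonFamilyKernel J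
  have hgood : ∀ᵐ g ∂P.map G, totalsKernel κΛ g = law (g.real Set.univ) := by
    filter_upwards [hG, hΛlaw] with g hg hl
    obtain ⟨r, hr, hκ⟩ := hl
    rw [totalsKernel_apply, hκ, pi_map_totals hc hg hr]
  have hmap : ((P.map G).map fun μ => (μ.real Set.univ, normalize μ)).map
      (fun z => ENNReal.ofReal z.1 • z.2) = P.map G := by
    rw [Measure.map_map measurable_smul_measure hj]
    conv_rhs => rw [← Measure.map_id (μ := P.map G)]
    refine Measure.map_congr ?_
    filter_upwards [hG] with g hg
    exact hg.ofReal_smul_normalize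
  have hset : MeasurableSet {z : ℝ × Measure Ω | 0 < z.1 ∧ IsProbabilityMeasure z.2} := by
    have h₁ : MeasurableSet {z : ℝ × Measure Ω | 0 < z.1} :=
      measurableSet_lt measurable_const (by fun_prop)
    exact h₁.inter
      (measurableSet_preimage (f := Prod.snd) measurable_snd measurableSet_isProbabilityMeasure)
  have hpos : ∀ᵐ z ∂(P.map G).map fun μ => (μ.real Set.univ, normalize μ),
      0 < z.1 ∧ IsProbabilityMeasure z.2 := by
    refine (ae_map_iff hj.aemeasurable hset).2 ?_
    filter_upwards [hG] with g hg
    exact ⟨hg.real_pos, hg.isProbabilityMeasure_normalize⟩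
  -- Independence of `α` and `G̃` makes this hold almost everywhere for the product law, so Fubini
  -- provides one fixed normalized measure that works for almost every mass.
  have hgood' : ∀ᵐ z ∂((P.map G).map fun μ => μ.real Set.univ).prod ((P.map G).map normalize),
      totalsKernel κΛ (ENNReal.ofReal z.1 • z.2) = law z.1 := by
    rw [← hprod]
    rw [← hmap] at hgood
    filter_upwards [hpos, ae_of_ae_map measurable_smul_measure.aemeasurable hgood] with z hz hz'
    have := hz.2
    rw [hz', real_univ_ofReal_smul hz.1]
  -- fix the normalized measure to turn the law of the totals into a kernel in the total mass
  obtain ⟨ν₀, hν₀⟩ : ∃ ν₀, ∀ᵐ a ∂(P.map G).map fun μ => μ.real Set.univ,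
      totalsKernel κΛ (ENNReal.ofReal a • ν₀) = law a := by
    rw [← Measure.prod_swap] at hgood'
    exact (Measure.ae_ae_of_ae_prod (ae_of_ae_map measurable_swap.aemeasurable hgood')).exists
  let ζ : Kernel ℝ ((J → ℝ) × (J → ℕ)) := (totalsKernel κΛ).comap
    (fun a => ENNReal.ofReal a • ν₀) (measurable_smul_measure.comp measurable_prodMk_right)
  have hζ : ∀ᵐ g ∂P.map G, totalsKernel κΛ g = ζ.comap (fun μ => μ.real Set.univ) hu g := by
    filter_upwards [hgood, ae_of_ae_map hu.aemeasurable hν₀] with g h1 h2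
    rw [h1, Kernel.comap_apply, Kernel.comap_apply, h2]
  have hkey : P.map (fun s => (((G s).real Set.univ, TN s), normalize (G s))) =
      (((P.map G).map fun μ => μ.real Set.univ) ⊗ₘ ζ).prod ((P.map G).map normalize) := by
    rw [← map_compProd_comap_eq_prod hu measurable_normalize hprod ζ,
      ← Measure.compProd_congr hζ, ← h.map_eq, Measure.map_map (by
        exact ((hu.comp measurable_fst).prodMk measurable_snd).prodMk
          (measurable_normalize.comp measurable_fst)) (hGm.prodMk hTN)]
    rfl
  exact (indepFun_of_map_eq_prod ((hu.comp hGm).prodMk hTN) (measurable_normalize.comp hGm)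
    hkey).symm

variable [Nonempty Ω] {E : Type*} [MeasurableSpace E]

/-- Given all totals, the normalization of `G` and the normalized mean measures, the points of
the Poisson processes are independent draws from the normalized mean measures. -/
theorem hasCondLaw_iidPoints {Y : S → J → E} (hGm : Measurable G) (hΛm : ∀ j, Measurable (Λ j))
    {N : S → J → ℕ} (hN : Measurable N)
    {κ : Kernel (Measure Ω × (J → Measure Ω)) (J → E)} [IsMarkovKernel κ]
    (h : HasCondDistrib Y (fun s => (G s, fun j => Λ j s)) κ P) {F : Points Ω → E}
    (hF : Measurable F)
    (hκ : ∀ᵐ w ∂P.map (fun s => (G s, fun j => Λ j s)),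
      κ w = Measure.pi fun j => (poissonPoints (w.2 j)).snd.map F)
    {len : E → ℕ} (hlen : Measurable len) (hlenF : ∀ x, len (F x) = x.1)
    (hNY : ∀ᵐ s ∂P, ∀ j, N s j = len (Y s j))
    (hprop : ∀ᵐ w ∂P.map (fun s => (G s, fun j => Λ j s)), ∀ j, HasProperMass (w.2 j)) :
    HasCondLaw P Y (fun s => ((((G s).real Set.univ, totals (fun j => Λ j s), N s),
        normalize (G s)), normalizeAll fun j => Λ j s))
      (fun z => IsProductLaw fun j ρ => ρ = (iidPoints (z.1.1.2.2 j) (z.2 j)).map F) := by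
  have hW : Measurable fun s => (G s, fun j => Λ j s) := hGm.prodMk (measurable_pi_iff.2 hΛm)
  have hψ : Measurable fun w : (Measure Ω × (J → Measure Ω)) × (J → ℕ) =>
      (((w.1.1.real Set.univ, totals w.1.2, w.2), normalize w.1.1), normalizeAll w.1.2) :=
    ((((measurable_real_apply MeasurableSet.univ).comp (measurable_fst.comp measurable_fst)).prodMk
      ((measurable_totals_snd.comp measurable_fst).prodMk measurable_snd)).prodMk
      (measurable_normalize.comp (measurable_fst.comp measurable_fst))).prodMk
      (measurable_normalizeAll.comp (measurable_snd.comp measurable_fst))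
  have hnum : Measurable fun z : ((ℝ × (J → ℝ) × (J → ℕ)) × Measure Ω) × (J → Measure Ω) =>
    z.1.1.2.2 := by fun_prop
  have h1 := hasCondDistrib_iidFamily (mean := Prod.snd) measurable_snd h hF hκ hlen hlenF
  have h2 : HasCondDistrib Y (fun s => ((G s, fun j => Λ j s), N s)) _ P :=
    hasCondDistrib_congr_right h1 (by
      filter_upwards [hNY] with s hs
      exact Prod.ext rfl (funext hs))
  refine ⟨iidFamilyKernel _ hnum Prod.snd measurable_snd hF, inferInstance, ?_, ?_⟩
  -- The draws use only the numbers and the normalized means, both of which are components of `ψ`.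
  · refine HasCondDistrib.comp_right (hf := hψ) (Z := fun s => ((G s, fun j => Λ j s), N s)) ?_
    convert h2 using 1
    ext w : 1
    rw [Kernel.comap_apply, iidFamilyKernel_apply, iidFamilyKernel_apply]
    rfl
  · have hset : MeasurableSet {z : ((ℝ × (J → ℝ) × (J → ℕ)) × Measure Ω) × (J → Measure Ω) |
        ∀ j, IsProbabilityMeasure (z.2 j)} := by
      have : {z : ((ℝ × (J → ℝ) × (J → ℕ)) × Measure Ω) × (J → Measure Ω) |
          ∀ j, IsProbabilityMeasure (z.2 j)} =
          ⋂ j, (fun z => z.2 j) ⁻¹' {μ | IsProbabilityMeasure μ} := by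
        ext; simp
      rw [this]
      exact MeasurableSet.iInter fun j =>
        measurableSet_preimage (by fun_prop) measurableSet_isProbabilityMeasure
    have hae : ∀ᵐ z ∂P.map (fun s => ((((G s).real Set.univ, totals (fun j => Λ j s), N s),
        normalize (G s)), normalizeAll fun j => Λ j s)), ∀ j, IsProbabilityMeasure (z.2 j) := by
      refine (ae_map_iff (hψ.comp (hW.prodMk hN)).aemeasurable hset).2 ?_
      filter_upwards [ae_of_ae_map hW.aemeasurable hprop] with s hs j
      exact (hs j).isProbabilityMeasure_normalize
    filter_upwards [hae] with z hz
    refine ⟨fun j => (iidPoints (z.1.1.2.2 j) (z.2 j)).map F, fun j => rfl, ?_⟩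
    rw [iidFamilyKernel_apply]
    congr 1
    ext1 j
    have := hz j
    rw [iidKernel_apply, pointKernel_apply]

/-- An exchangeable listing of the points of independent Poisson processes consists of Poisson
numbers of independent points. -/
theorem hasCondDistrib_listing {κX : Kernel (Measure Ω × (J → Measure Ω)) (J → Measure Ω)}
    [IsMarkovKernel κX] (hGm : Measurable G) (hΛm : ∀ j, Measurable (Λ j))
    (hX : HasCondDistrib (fun s j => X j s) (fun s => (G s, fun j => Λ j s)) κX P)
    (hκ : ∀ᵐ w ∂P.map (fun s => (G s, fun j => Λ j s)),
      κX w = Measure.pi fun j => (poissonPoints (w.2 j)).snd.map counting)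
    {x : J → S → Points Ω} (hx : IsExchangeableListing P G Λ X x) :
    HasCondDistrib (fun s j => x j s) (fun s => (G s, fun j => Λ j s))
      (piKernel fun j => (poissonPointsKernel Ω).comap
        (fun w : Measure Ω × (J → Measure Ω) => w.2 j) (by fun_prop)) P := by
  have hW : Measurable fun s => (G s, fun j => Λ j s) := hGm.prodMk (measurable_pi_iff.2 hΛm)
  have hxm : Measurable fun s j => x j s := measurable_pi_iff.2 hx.measurable
  refine ⟨(hW.prodMk hxm).aemeasurable, ?_⟩
  have hr (τ : J → ∀ n : ℕ, Equiv.Perm (Fin n)) :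
      Measurable fun (y : J → Points Ω) j => reorder (τ j) (y j) :=
    measurable_pi_iff.2 fun j => (measurable_reorder (τ j)).comp (measurable_pi_apply j)
  have hcm : Measurable fun (y : J → Points Ω) j => counting (y j) :=
    measurable_pi_iff.2 fun j => measurable_counting.comp (measurable_pi_apply j)
  have : IsProbabilityMeasure (P.map fun s => (G s, fun j => Λ j s)) :=
    Measure.isProbabilityMeasure_map hW.aemeasurable
  -- Jointly with `(G, Λ)`, the given listing and the independent draws are both invariant under
  -- reordering and have the same counting measures, hence the same law.
  refine ext_prod_of_map_counting (fun τ => ?_) (fun τ => ?_) ?_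
  · rw [Measure.map_map (by exact measurable_fst.prodMk ((hr τ).comp measurable_snd))
      (hW.prodMk hxm)]
    exact hx.exchangeable τ
  · refine Eq.trans (Measure.compProd_map (hr τ)).symm ?_
    congr 1
    ext w : 1
    rw [Kernel.map_apply _ (hr τ), piKernel_apply]
    have hprob (j : J) : IsProbabilityMeasure (((poissonPointsKernel Ω).comap
        (fun w : Measure Ω × (J → Measure Ω) => w.2 j) (by fun_prop) w).map (reorder (τ j))) :=
      Measure.isProbabilityMeasure_map (measurable_reorder (τ j)).aemeasurable
    refine (Measure.pi_map_pi fun j => (measurable_reorder (τ j)).aemeasurable).trans ?_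
    simp only [Kernel.comap_apply, poissonPointsKernel_apply, poissonPoints_snd_map_reorder]
  · have h1 : (P.map fun s => ((G s, fun j => Λ j s), fun j => x j s)).map
        (fun z => (z.1, fun j => counting (z.2 j))) =
          P.map (fun s => ((G s, fun j => Λ j s), fun j => X j s)) := by
      rw [Measure.map_map (by exact measurable_fst.prodMk (hcm.comp measurable_snd))
        (hW.prodMk hxm)]
      refine Measure.map_congr ?_
      filter_upwards [ae_all_iff.2 hx.counting_eq] with s hs
      simp [hs]
    rw [h1, hX.map_eq]
    refine Eq.trans (Measure.compProd_congr (κ := κX) ?_) (Measure.compProd_map hcm)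
    have hmk := Kernel.IsMarkovKernel.map (piKernel fun j => (poissonPointsKernel Ω).comap
        (fun w : Measure Ω × (J → Measure Ω) => w.2 j) (by fun_prop)) hcm
    filter_upwards [hκ] with w hw
    rw [hw, Kernel.map_apply _ hcm, piKernel_apply]
    have hprob (j : J) : IsProbabilityMeasure (((poissonPointsKernel Ω).comap
        (fun w : Measure Ω × (J → Measure Ω) => w.2 j) (by fun_prop) w).map counting) :=
      Measure.isProbabilityMeasure_map measurable_counting.aemeasurable
    refine Eq.trans ?_ (Measure.pi_map_pi fun j => measurable_counting.aemeasurable).symm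
    simp only [Kernel.comap_apply, poissonPointsKernel_apply]

end Normalized

end GammaNB

end

/-! ### Assembly of the hierarchical Dirichlet process. -/

theorem mainTheorem4 {Ω S J : Type*} [MeasurableSpace Ω] [MeasurableSpace S] [Fintype J]
    (P : Measure S) [IsProbabilityMeasure P]
    -- parameters of the gamma-NB process
    (c : ℝ) (hc : 0 < c) (G₀ : Measure Ω) [IsFiniteMeasure G₀] (hG₀ : G₀ ≠ 0)
    (p : J → ℝ) (hp : ∀ j, 0 < p j ∧ p j < 1)
    (G : S → Measure Ω) (Λ X : J → S → Measure Ω)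
    (hmodel : GammaNB.IsGammaNBProcess P c G₀ p G Λ X)
    -- total masses `γ₀ = G₀(Ω)`, `α = G(Ω)`, `T_j = Λ_j(Ω)`, `N_j = X_j(Ω)`
    (γ₀ : ℝ) (hγ₀ : γ₀ = G₀.real Set.univ)
    (α : S → ℝ) (hα : ∀ s, α s = (G s).real Set.univ)
    (T : S → J → ℝ) (hT : ∀ s j, T s j = (Λ j s).real Set.univ)
    (N : S → J → ℕ) (hN : ∀ s j, N s j = ⌊(X j s).real Set.univ⌋₊)
    -- normalized measures
    (Gn : S → Measure Ω) (hGn : ∀ s, Gn s = GammaNB.normalize (G s))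
    (Λn : S → J → Measure Ω) (hΛn : ∀ s j, Λn s j = GammaNB.normalize (Λ j s)) :
    -- the total counts are natural numbers
    (∀ j, ∀ᵐ s ∂P, X j s Set.univ = (N s j : ENNReal)) ∧
    -- `α ~ Gamma(γ₀, 1 / c)`
    HasLaw α (gammaMeasure γ₀ c) P ∧
    -- `G̃ ~ DP(γ₀, G̃₀)`, independently of `α` and of the totals
    (AEMeasurable Gn P ∧
      GammaNB.IsDirichletProcessLaw γ₀ (GammaNB.normalize G₀) (P.map Gn) ∧
      IndepFun Gn (fun s => (α s, T s, N s)) P) ∧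
    -- given `α`, `G̃` and the totals, the `Λ̃_j` are independent with `Λ̃_j ~ DP(α, G̃)`
    GammaNB.HasCondLaw P Λn (fun s => ((α s, T s, N s), Gn s))
      (fun z => GammaNB.IsProductLaw fun _ => GammaNB.IsDirichletProcessLaw z.1.1 z.2) ∧
    -- given all of these, the `X_j` are independent, and `X_j` is the counting measure of `N_j`
    -- independent points with law `Λ̃_j`
    GammaNB.HasCondLaw P (fun s j => X j s) (fun s => (((α s, T s, N s), Gn s), Λn s))
      (fun z => GammaNB.IsProductLaw fun j ρ =>
        ρ = (GammaNB.iidPoints (z.1.1.2.2 j) (z.2 j)).map GammaNB.counting) ∧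
    -- for every exchangeable listing of the points: `X_{ji} ~ Λ̃_j`, independently
    (∀ x : J → S → GammaNB.Points Ω, GammaNB.IsExchangeableListing P G Λ X x →
      GammaNB.HasCondLaw P (fun s j => x j s) (fun s => (((α s, T s, N s), Gn s), Λn s))
        (fun z => GammaNB.IsProductLaw fun j ρ =>
          ρ = GammaNB.iidPoints (z.1.1.2.2 j) (z.2 j))) := by
  open GammaNB in
  obtain rfl : α = fun s => (G s).real Set.univ := funext hα
  obtain rfl : T = fun s => totals fun j => Λ j s := funext fun s => funext fun j => hT s j
  obtain rfl : N = fun s j => totalCount (X j s) := funext fun s => funext fun j => hN s j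
  obtain rfl : Gn = fun s => normalize (G s) := funext hGn
  obtain rfl : Λn = fun s => normalizeAll fun j => Λ j s := funext fun s => funext fun j => hΛn s j
  subst hγ₀
  obtain ⟨hGm, hΛm, hXm, hlaw, ⟨κΛ, hκΛ, hΛ, hΛlaw⟩, ⟨κX, hκX, hX, hXlaw⟩⟩ := hmodel
  have : Nonempty Ω := by
    by_contra hcon
    rw [not_nonempty_iff] at hcon
    exact hG₀ (Measure.eq_zero_of_isEmpty G₀)
  have hr : ∀ j, 0 < (1 - p j) / p j := fun j =>
    div_pos (by linarith [(hp j).2]) (hp j).1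
  have hu : Measurable fun μ : Measure Ω => μ.real Set.univ :=
    measurable_real_apply MeasurableSet.univ
  have hΛm' : Measurable fun s j => Λ j s := measurable_pi_iff.2 hΛm
  have hNm : Measurable fun s j => totalCount (X j s) :=
    measurable_pi_iff.2 fun j => measurable_totalCount.comp (hXm j)
  have hTN : Measurable fun s => (totals (fun j => Λ j s), fun j => totalCount (X j s)) :=
    (measurable_totals.comp hΛm').prodMk hNm
  have hG : ∀ᵐ g ∂P.map G, HasProperMass g :=
    hlaw.ae_hasProperMass hc ⟨by simpa using hG₀, measure_ne_top _ _⟩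
  have hprop := ae_hasProperMass_Λ hr hG hΛ hΛlaw
  have hκ := ae_eq_pi_map_counting hprop hXlaw
  have hjoint := hasCondDistrib_totals_normalizeAll hr hG hΛ hΛlaw hX hXlaw
  have htot : HasCondDistrib (fun s => (totals (fun j => Λ j s), fun j => totalCount (X j s))) G
      (totalsKernel κΛ) P := by
    have h1 := hjoint.fst
    rwa [Kernel.fst_compProd] at h1
  have hcount := ae_eq_totalCount hX hκ
  refine ⟨hcount, ⟨(hu.comp hGm).aemeasurable, ?_⟩,
    ⟨(measurable_normalize.comp hGm).aemeasurable, ?_, ?_⟩, ?_, ?_, fun x hx => ?_⟩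
  · rw [← hlaw.map_real_univ hc hG₀, Measure.map_map hu hGm]
    rfl
  · have h1 := hlaw.isDirichletProcessLaw_normalize hc hG₀
    rwa [Measure.map_map measurable_normalize hGm] at h1
  · exact indepFun_normalize_totals hc hG₀ hlaw hr hGm hTN hG hΛlaw htot
  · exact hasCondLaw_normalizeAll hr hGm hTN hG hΛlaw hjoint
  · exact hasCondLaw_iidPoints hGm hΛm hNm hX measurable_counting hκ measurable_totalCount
      totalCount_counting (Filter.Eventually.of_forall fun s j => rfl) hprop
  -- The argument for the `X_j` applies to the lists with the identity in place of `counting`; the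
  -- number of points is now the length of the list.
  · have h1 := hasCondLaw_iidPoints hGm hΛm hNm (hasCondDistrib_listing hGm hΛm hX hκ hx)
      measurable_id (Filter.Eventually.of_forall fun w => by
        rw [piKernel_apply]
        simp only [Kernel.comap_apply, poissonPointsKernel_apply, Measure.map_id])
      measurable_length (fun x => rfl) (by
        filter_upwards [ae_all_iff.2 hx.counting_eq] with s hs j
        rw [hs j, totalCount_counting]) hprop
    simpa only [Measure.map_id] using h1
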